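/- Let $k$ be a field. Algebras are associative $k$-algebras, possibly without unity; $r(A)$ denotes the Jacobson radical of $A$ (its largest quasi-regular ideal). **Generalized path algebras.** Let $D$ be a directed graph with vertex set $D_0=I$ (possibly infinite, with multiple arrows and loops allowed), and for each $i\in I$ let $\Omega_{ii}$ be a $k$-algebra with unity element $e_{ii}\neq 0$ and $r(\Omega_{ii})=0$. A generalized path from $i_0$ to $i_n$ is a sequence $a_{i_0}x_{i_0i_1}a_{i_1}\cdots x_{i_{n-1}i_n}a_{i_n}$ ($n\ge 0$) with arrows $x_{i_{p}i_{p+1}}:i_p\to i_{p+1}$ and $a_{i_p}\in\Omega_{i_pi_p}$. The generalized path algebra $k(D,\Omega)$ is the $k$-vector space spanned by all generalized paths, modulo $k$-linearity in each entry $a_{i_p}$, with the multiplication induced by $$(a_{i_0}x_{i_0i_1}\cdots a_{i_n})(b_{j_0}y_{j_0j_1}\cdots b_{j_m})=a_{i_0}x_{i_0i_1}\cdots (a_{i_n}b_{j_0})y_{j_0j_1}\cdots b_{j_m}\quad\text{if } i_n=j_0,$$ and $0$ if $i_n\ne j_0$. Let $J$ be the ideal generated by all arrows, an arrow $x:i\to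 j$ being identified with $e_{ii}xe_{jj}$. If $\rho\subseteq k(D,\Omega)$ is a non-empty subset and the ideal $(\rho)$ generated by $\rho$ satisfies $J^t\subseteq(\rho)\subseteq J$ for some $t\ge 1$, then $k(D,\Omega,\rho):=k(D,\Omega)/(\rho)$ is called a generalized path algebra with weak relations. **Further notions.** An algebra $\Lambda$ *can be lifted* if $\Lambda=A\oplus r(\Lambda)$ as vector spaces for some subalgebra $A$. For an algebra $\Lambda$, if $\Lambda/r(\Lambda)$ is (left or right) artinian with non-zero unity element, then $\Lambda/r(\Lambda)=B_1\oplus\cdots\oplus B_n$ as algebras with simple subalgebras $B_i$, and the Wedderburn–Artin number is $n_{WA}(\Lambda):=n$; otherwise $n_{WA}(\Lambda):=\infty$. **Corollary 3.11.** (i) If $k(D,\Omega,\rho)$ is a generalized path algebra with weak relations, then $|D_0|\le n_{WA}(k(D,\Omega,\rho))$ (where this holds for every $D_0$ if the right-hand side is $\infty$). (ii) Let $\Lambda$ be an algebra with non-zero unity element that can be lifted and whose Jacobson radical $r=r(\Lambda)$ is nilpotent. If $\Lambda/r=B_1\oplus\cdots\oplus B_n$ as algebras, with non-zero subalgebras $B_i$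 of $\Lambda/r$, then $\Lambda$ is isomorphic to a generalized path algebra $k(D,\Omega,\rho)$ with weak relations such that $D_0=\{1,\dots,n\}$ and $\Omega_{ii}=B_i$ for all $i$. (iii) Let $\Lambda$ be an algebra with non-zero unity element that can be lifted and whose Jacobson radical $r$ is nilpotent, and assume that $\Lambda/r$ is (left or right) artinian. Then for every integer $m\ge 1$ with $m\le n_{WA}(\Lambda)$, $\Lambda$ is isomorphic to a generalized path algebra $k(D,\Omega,\rho)$ with weak relations and $|D_0|=m$. -/

import Mathlib

universe u v w x y

/-! ## Algebras over a field, possibly without unity element -/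

/-- A two-sided ideal of a (possibly non-unital) `k`-algebra `A`. -/
structure AlgIdeal (k : Type*) (A : Type*) [Field k] [NonUnitalRing A] [Module k A]
    extends Submodule k A where
  mul_mem_left' : ∀ a b : A, b ∈ carrier → a * b ∈ carrier
  mul_mem_right' : ∀ a b : A, b ∈ carrier → b * a ∈ carrier

namespace AlgIdeal

section Basic

variable {k : Type*} {A : Type*} [Field k] [NonUnitalRing A] [Module k A]

instance : Membership A (AlgIdeal k A) where
  mem I a := a ∈ I.toSubmodule

/-- The ideal generated by a set: the smallest ideal that contains it. -/
def span (s : Set A) : AlgIdeal k A where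
  toSubmodule := sInf {N : Submodule k A | ∃ I : AlgIdeal k A, s ⊆ {a | a ∈ I} ∧ I.toSubmodule = N}
  mul_mem_left' a b hb := by
    change b ∈ (sInf _ : Submodule k A) at hb
    change a * b ∈ (sInf _ : Submodule k A)
    rw [Submodule.mem_sInf] at hb ⊢
    rintro N ⟨I, hI, rfl⟩
    exact I.mul_mem_left' a b (hb _ ⟨I, hI, rfl⟩)
  mul_mem_right' a b hb := by
    change b ∈ (sInf _ : Submodule k A) at hb
    change b * a ∈ (sInf _ : Submodule k A)
    rw [Submodule.mem_sInf] at hb ⊢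
    rintro N ⟨I, hI, rfl⟩
    exact I.mul_mem_right' a b (hb _ ⟨I, hI, rfl⟩)

/-- The powers of an ideal: for `t ≥ 1`, `I.pow t` is the span of all products of `t` elements
of `I`. -/
def pow (I : AlgIdeal k A) : ℕ → Submodule k A
  | 0 => ⊤
  | 1 => I.toSubmodule
  | (n + 2) => Submodule.span k {c | ∃ a ∈ pow I (n + 1), ∃ b ∈ I, c = a * b}

/-- The ideal `I` is nilpotent: `I ^ t = 0` for some `t ≥ 1`. -/
def IsNilpotent (I : AlgIdeal k A) : Prop := ∃ t : ℕ, 1 ≤ t ∧ I.pow t = ⊥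

/-- The quotient algebra `A / I`. -/
def Quotient (I : AlgIdeal k A) : Type _ := A ⧸ I.toSubmodule

namespace Quotient

variable (I : AlgIdeal k A)

instance : AddCommGroup I.Quotient := inferInstanceAs (AddCommGroup (A ⧸ I.toSubmodule))

instance : Module k I.Quotient := inferInstanceAs (Module k (A ⧸ I.toSubmodule))

/-- The canonical projection `A → A / I`. -/
def mk : A →ₗ[k] I.Quotient := I.toSubmodule.mkQ

theorem mk_surjective : Function.Surjective (mk I) := Submodule.mkQ_surjective _

theorem mk_eq_mk {a b : A} : mk I a = mk I b ↔ a - b ∈ I := Submodule.Quotient.eq _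

instance : Mul I.Quotient where
  mul := Quotient.map₂ (· * ·) (by
    intro a a' ha b b' hb
    have ha : a - a' ∈ I.toSubmodule := (Submodule.quotientRel_def _).1 ha
    have hb : b - b' ∈ I.toSubmodule := (Submodule.quotientRel_def _).1 hb
    refine (Submodule.quotientRel_def _).2 ?_
    have h : a * b - a' * b' = (a - a') * b + a' * (b - b') := by noncomm_ring
    rw [h]
    exact I.toSubmodule.add_mem (I.mul_mem_right' _ _ ha) (I.mul_mem_left' _ _ hb))

theorem mk_mul (a b : A) : mk I (a * b) = mk I a * mk I b := rfl

instance : NonUnitalRing I.Quotient where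
  left_distrib a b c := by
    obtain ⟨a, rfl⟩ := mk_surjective I a
    obtain ⟨b, rfl⟩ := mk_surjective I b
    obtain ⟨c, rfl⟩ := mk_surjective I c
    rw [← map_add, ← mk_mul, ← mk_mul, ← mk_mul, ← map_add, mul_add]
  right_distrib a b c := by
    obtain ⟨a, rfl⟩ := mk_surjective I a
    obtain ⟨b, rfl⟩ := mk_surjective I b
    obtain ⟨c, rfl⟩ := mk_surjective I c
    rw [← map_add, ← mk_mul, ← mk_mul, ← mk_mul, ← map_add, add_mul]
  zero_mul a := by
    obtain ⟨a, rfl⟩ := mk_surjective I a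
    rw [← map_zero (mk I), ← mk_mul, zero_mul]
  mul_zero a := by
    obtain ⟨a, rfl⟩ := mk_surjective I a
    rw [← map_zero (mk I), ← mk_mul, mul_zero]
  mul_assoc a b c := by
    obtain ⟨a, rfl⟩ := mk_surjective I a
    obtain ⟨b, rfl⟩ := mk_surjective I b
    obtain ⟨c, rfl⟩ := mk_surjective I c
    rw [← mk_mul, ← mk_mul, ← mk_mul, ← mk_mul, mul_assoc]

instance [IsScalarTower k A A] : IsScalarTower k I.Quotient I.Quotient where
  smul_assoc c a b := by
    obtain ⟨a, rfl⟩ := mk_surjective I a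
    obtain ⟨b, rfl⟩ := mk_surjective I b
    rw [smul_eq_mul, smul_eq_mul, ← map_smul, ← mk_mul, ← mk_mul, ← map_smul, smul_mul_assoc]

instance [SMulCommClass k A A] : SMulCommClass k I.Quotient I.Quotient where
  smul_comm c a b := by
    obtain ⟨a, rfl⟩ := mk_surjective I a
    obtain ⟨b, rfl⟩ := mk_surjective I b
    rw [smul_eq_mul, smul_eq_mul, ← map_smul, ← mk_mul, ← mk_mul, ← map_smul, mul_smul_comm]

end Quotient

end Basic

end AlgIdeal

section Radical

variable (k : Type*) (A : Type*) [Field k] [NonUnitalRing A] [Module k A]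

/-- The Jacobson radical of a possibly non-unital algebra: the largest quasi-regular ideal, that
is, the sum of all ideals that consist of quasi-regular elements. -/
def jacobsonRadical : AlgIdeal k A :=
  AlgIdeal.span {a | ∃ I : AlgIdeal k A, a ∈ I ∧ ∀ b ∈ I, IsQuasiregular b}

/-- The algebra `A` can be lifted: `A = S ⊕ r(A)` as vector spaces for some subalgebra `S`. -/
def CanBeLifted : Prop :=
  ∃ S : NonUnitalSubalgebra k A, IsCompl S.toSubmodule (jacobsonRadical k A).toSubmodule

/-- Left artinian: descending chain condition on left ideals. -/
def IsLeftArtinianAlg : Prop :=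
  WellFoundedLT {L : Submodule k A // ∀ a : A, ∀ b ∈ L, a * b ∈ L}

/-- Right artinian: descending chain condition on right ideals. -/
def IsRightArtinianAlg : Prop :=
  WellFoundedLT {L : Submodule k A // ∀ a : A, ∀ b ∈ L, b * a ∈ L}

/-- Left or right artinian. -/
def IsArtinianAlg : Prop := IsLeftArtinianAlg k A ∨ IsRightArtinianAlg k A

variable {k A}

/-- `A = B 1 ⊕ ... ⊕ B n` as algebras: `A` is the internal direct sum of the subspaces `B i`, and
the product of elements of two different summands is zero. -/
def IsAlgDirectSum {n : ℕ} (B : Fin n → NonUnitalSubalgebra k A) : Prop :=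
  DirectSum.IsInternal (fun i => (B i).toSubmodule) ∧
    ∀ i j, i ≠ j → ∀ a ∈ B i, ∀ b ∈ B j, a * b = 0

variable (k A)

open Classical in
/-- The Wedderburn–Artin number: if `A / r(A)` is artinian with non-zero unity element, the number
`n` of summands in a decomposition `A / r(A) = B 1 ⊕ ... ⊕ B n` into simple subalgebras (which
exists, and all of which have the same number of summands); otherwise `∞`. -/
noncomputable def wedderburnArtinNumber : ℕ∞ :=
  if (∃ u : (jacobsonRadical k A).Quotient, u ≠ 0 ∧ ∀ a, u * a = a ∧ a * u = a) ∧
      IsArtinianAlg k (jacobsonRadical k A).Quotient then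
    sInf {N : ℕ∞ | ∃ n : ℕ, N = n ∧
      ∃ B : Fin n → NonUnitalSubalgebra k (jacobsonRadical k A).Quotient,
        IsAlgDirectSum B ∧ ∀ i, IsSimpleRing (B i)}
  else ⊤

end Radical

/-! ## Generalized path algebras -/

/-- A directed graph with vertex set `I` is given by the sets `D i j` of arrows from `i` to `j`.
A generalized path from `i` to `j` is a sequence `a₀ x₁ a₁ x₂ ⋯ xₙ aₙ`, where `x₁, …, xₙ` are
consecutive arrows that lead from `i` to `j` and each `aₚ` lies in the algebra `Ω` at the
vertex it sits at. (Entries `aₚ = 0` are allowed here; the linearity relations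
below make such a path zero.) -/
inductive OmegaPath {I : Type u} (D : I → I → Type v) (Ω : I → Type w) :
    I → I → Type (max u v w)
  | nil {i : I} (a : Ω i) : OmegaPath D Ω i i
  | cons {i j l : I} (a : Ω i) (x : D i j) (p : OmegaPath D Ω j l) : OmegaPath D Ω i l

namespace OmegaPath

variable {I : Type u} {D : I → I → Type v} {Ω : I → Type w}

/-- `a * (a₀ x₁ a₁ ⋯) = (a * a₀) x₁ a₁ ⋯`. -/
def lmul [∀ i, Mul (Ω i)] : ∀ {i j : I}, Ω i → OmegaPath D Ω i j → OmegaPath D Ω i j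
  | _, _, a, nil b => nil (a * b)
  | _, _, a, cons b x p => cons (a * b) x p

/-- `(a₀ x₁ ⋯ xₙ aₙ) * (b₀ y₁ ⋯ yₘ bₘ) = a₀ x₁ ⋯ xₙ (aₙ * b₀) y₁ ⋯ yₘ bₘ`. -/
def comp [∀ i, Mul (Ω i)] :
    ∀ {i j l : I}, OmegaPath D Ω i j → OmegaPath D Ω j l → OmegaPath D Ω i l
  | _, _, _, nil a, q => lmul a q
  | _, _, _, cons a x p, q => cons a x (comp p q)

theorem lmul_lmul [∀ i, Semigroup (Ω i)] {i j : I} (a b : Ω i) (p : OmegaPath D Ω i j) :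
    lmul a (lmul b p) = lmul (a * b) p := by
  cases p <;> simp [lmul, mul_assoc]

theorem lmul_comp [∀ i, Semigroup (Ω i)] {i j l : I} (a : Ω i) (p : OmegaPath D Ω i j)
    (q : OmegaPath D Ω j l) : comp (lmul a p) q = lmul a (comp p q) := by
  cases p with
  | nil b => exact (lmul_lmul a b q).symm
  | cons b x p => rfl

theorem comp_assoc [∀ i, Semigroup (Ω i)] {i j l m : I} (p : OmegaPath D Ω i j)
    (q : OmegaPath D Ω j l) (r : OmegaPath D Ω l m) :
    comp (comp p q) r = comp p (comp q r) := by
  induction p with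
  | nil a => exact lmul_comp a q r
  | cons a x p ih => simp [comp, ih]

/-- `LinRel c d p q s`: the paths `p`, `q`, `s` have the same arrows and agree in all entries but
one, in which `p` has an element `a`, `q` has an element `b`, and `s` has `c • a + d • b`. -/
inductive LinRel {k : Type*} [∀ i, Add (Ω i)] [∀ i, SMul k (Ω i)] (c d : k) :
    ∀ {i j : I}, OmegaPath D Ω i j → OmegaPath D Ω i j → OmegaPath D Ω i j → Prop
  | nil {i : I} (a b : Ω i) : LinRel c d (nil a) (nil b) (nil (c • a + d • b))
  | head {i j l : I} (a b : Ω i) (x : D i j) (p : OmegaPath D Ω j l) :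
      LinRel c d (cons a x p) (cons b x p) (cons (c • a + d • b) x p)
  | tail {i j l : I} (a : Ω i) (x : D i j) {p q s : OmegaPath D Ω j l} (h : LinRel c d p q s) :
      LinRel c d (cons a x p) (cons a x q) (cons a x s)

end OmegaPath

/-- All generalized paths, between arbitrary vertices, together with a zero symbol that serves as
the product of two paths that cannot be concatenated. -/
inductive OmegaWord {I : Type u} (D : I → I → Type v) (Ω : I → Type w) : Type (max u v w)
  | zero : OmegaWord D Ω
  | path {i j : I} (p : OmegaPath D Ω i j) : OmegaWord D Ω

namespace OmegaWord

variable {I : Type u} {D : I → I → Type v} {Ω : I → Type w}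

open Classical in
/-- Concatenation of paths where possible, and zero otherwise. -/
noncomputable def mul [∀ i, Mul (Ω i)] : OmegaWord D Ω → OmegaWord D Ω → OmegaWord D Ω
  | path (i := _) (j := j) p, path (i := j') (j := _) q =>
      if h : j' = j then path (p.comp (h ▸ q)) else zero
  | _, _ => zero

noncomputable instance [∀ i, Mul (Ω i)] : Mul (OmegaWord D Ω) := ⟨mul⟩

theorem zero_mul' [∀ i, Mul (Ω i)] (p : OmegaWord D Ω) : zero * p = zero := by
  cases p <;> rfl

theorem mul_zero' [∀ i, Mul (Ω i)] (p : OmegaWord D Ω) : p * zero = zero := by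
  cases p <;> rfl

theorem path_mul_path [∀ i, Mul (Ω i)] {i j l : I} (p : OmegaPath D Ω i j)
    (q : OmegaPath D Ω j l) : path p * path q = path (p.comp q) := by
  change mul _ _ = _
  simp [mul]

theorem path_mul_path_of_ne [∀ i, Mul (Ω i)] {i j j' l : I} (h : j ≠ j') (p : OmegaPath D Ω i j)
    (q : OmegaPath D Ω j' l) : path p * path q = zero := by
  change mul _ _ = _
  simp [mul, h.symm]

noncomputable instance [∀ i, Semigroup (Ω i)] : Semigroup (OmegaWord D Ω) where
  mul_assoc p q r := by
    cases p with
    | zero => simp only [zero_mul']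
    | @path i j p =>
    cases q with
    | zero => simp only [zero_mul', mul_zero']
    | @path j' l q =>
    cases r with
    | zero => simp only [mul_zero']
    | @path l' m r =>
    by_cases h : j = j'
    · subst h
      by_cases h' : l = l'
      · subst h'
        simp only [path_mul_path, OmegaPath.comp_assoc]
      · simp only [path_mul_path, path_mul_path_of_ne h', mul_zero']
    · by_cases h' : l = l'
      · subst h'
        simp only [path_mul_path, path_mul_path_of_ne h, zero_mul']
      · simp only [path_mul_path_of_ne h, path_mul_path_of_ne h', zero_mul', mul_zero']

end OmegaWord

section GeneralizedPathAlgebra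

variable (k : Type y) [Field k] {I : Type u} (D : I → I → Type v) (Ω : I → Type w)
  [∀ i, NonUnitalRing (Ω i)] [∀ i, Module k (Ω i)]

/-- The ideal, in the algebra with basis all words, that identifies the zero symbol with `0` and
makes every generalized path `k`-linear in each of its entries. -/
noncomputable def omegaRelations : AlgIdeal k (MonoidAlgebra k (OmegaWord D Ω)) :=
  AlgIdeal.span ({MonoidAlgebra.single OmegaWord.zero 1} ∪
    {f | ∃ (c d : k) (i j : I) (p q s : OmegaPath D Ω i j), OmegaPath.LinRel c d p q s ∧
      f = MonoidAlgebra.single (.path s) 1 - c • MonoidAlgebra.single (.path p) 1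
        - d • MonoidAlgebra.single (.path q) 1})

/-- The generalized path algebra `k(D, Ω)`: the vector space spanned by all generalized paths,
modulo linearity in each entry, with multiplication induced by concatenation. It is the direct sum
over `i, j` of its subspaces spanned by the paths from `i` to `j`. -/
abbrev GenPathAlgebra : Type _ := (omegaRelations k D Ω).Quotient

variable {Ω}

/-- The class of a generalized path in `k(D, Ω)`. -/
noncomputable def GenPathAlgebra.ofPath {i j : I} (p : OmegaPath D Ω i j) : GenPathAlgebra k D Ω :=
  AlgIdeal.Quotient.mk _ (MonoidAlgebra.single (.path p) 1)

/-- The conditions on the vertex algebras in a generalized path algebra: `e i` is a non-zero unity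
element of `Ω i`, and the Jacobson radical of `Ω i` is zero. -/
structure IsVertexSystem (e : ∀ i, Ω i) : Prop where
  e_ne_zero : ∀ i, e i ≠ 0
  e_mul : ∀ i (a : Ω i), e i * a = a
  mul_e : ∀ i (a : Ω i), a * e i = a
  radical_eq_zero : ∀ i, (jacobsonRadical k (Ω i)).toSubmodule = ⊥

/-- The ideal `J` of `k(D, Ω)` generated by all arrows, an arrow `x : i → j` being the path
`e i x e j`. -/
noncomputable def arrowIdeal (e : ∀ i, Ω i) : AlgIdeal k (GenPathAlgebra k D Ω) :=
  AlgIdeal.span {a | ∃ (i j : I) (x : D i j),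
    a = GenPathAlgebra.ofPath k D (OmegaPath.cons (e i) x (OmegaPath.nil (e j)))}

/-- `ρ` is a set of weak relations: it is non-empty and `J ^ t ⊆ (ρ) ⊆ J` for some `t ≥ 1`. -/
def IsWeakRelations (e : ∀ i, Ω i) (ρ : Set (GenPathAlgebra k D Ω)) : Prop :=
  ρ.Nonempty ∧
  (∃ t : ℕ, 1 ≤ t ∧ (arrowIdeal k D e).pow t ≤ (AlgIdeal.span (k := k) ρ).toSubmodule) ∧
  (AlgIdeal.span (k := k) ρ).toSubmodule ≤ (arrowIdeal k D e).toSubmodule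

variable {D}

/-- The algebra `k(D, Ω, ρ) = k(D, Ω) / (ρ)`. -/
abbrev GenPathAlgebraMod (ρ : Set (GenPathAlgebra k D Ω)) : Type _ :=
  (AlgIdeal.span (k := k) ρ).Quotient

end GeneralizedPathAlgebra

/-- Two (possibly non-unital) `k`-algebras are isomorphic. -/
def AlgIsomorphic (k : Type*) [Field k] (A B : Type*) [NonUnitalRing A] [Module k A]
    [NonUnitalRing B] [Module k B] : Prop :=
  ∃ f : A →ₙₐ[k] B, Function.Bijective f

/-! For (i), the vertex units `e i` map to elements `E i` of the algebra modulo its radical. They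
are non-zero: an idempotent in the radical vanishes, so otherwise `e i` would lie in (ρ) ⊆ J, while
J contains no non-zero vertex element (`eq_zero_of_vertexMap_mem`). For i ≠ j, every `E i * a * E j`
is zero: paths from i to j contain an arrow, and J has nilpotent image because J^t ⊆ (ρ). Simple
rings are prime, so each simple summand can meet at most one `E i` (`IsAlgDirectSum.card_le`).

For (ii), the lifting gives a multiplicative section s of Λ → Λ/r. Take every element of r as an
arrow between every pair of vertices, and evaluate paths in Λ, with s on the vertex entries. This
map φ is onto because Λ = s(Λ/r) + r and the `s (e i)` sum to 1. It sends J into r, so its kernel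
contains J^t when r^t = 0. Modulo J only vertex elements remain, and φ followed by the projection to
Λ/r is injective on their sums, so the kernel lies in J. The kernel therefore serves as ρ.

For (iii), Λ/r has no non-zero quasi-regular ideal, so it is semisimple if artinian, and
Wedderburn–Artin decomposes it. Adding up central idempotents merges the summands into any smaller
positive number of blocks, and (ii) applies. -/

/-! ## Ideals, quotients and quasi-regular elements -/

namespace AlgIdeal

section Basic

variable {k : Type*} {A B : Type*} [Field k] [NonUnitalRing A] [Module k A]
  [NonUnitalRing B] [Module k B]

theorem mul_mem_left (I : AlgIdeal k A) (a : A) {b : A} (hb : b ∈ I) : a * b ∈ I :=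
  I.mul_mem_left' a b hb

theorem mul_mem_right (I : AlgIdeal k A) (a : A) {b : A} (hb : b ∈ I) : b * a ∈ I :=
  I.mul_mem_right' a b hb

theorem neg_mem (I : AlgIdeal k A) {a : A} (ha : a ∈ I) : -a ∈ I :=
  I.toSubmodule.neg_mem ha

theorem mem_span {s : Set A} {a : A} :
    a ∈ span (k := k) s ↔ ∀ I : AlgIdeal k A, (∀ b ∈ s, b ∈ I) → a ∈ I := by
  change a ∈ (sInf _ : Submodule k A) ↔ _
  rw [Submodule.mem_sInf]
  constructor
  · intro h I hI
    exact h _ ⟨I, hI, rfl⟩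
  · rintro h N ⟨I, hI, rfl⟩
    exact h I hI

theorem subset_span {s : Set A} {a : A} (ha : a ∈ s) : a ∈ span (k := k) s :=
  mem_span.2 fun _ hI => hI a ha

theorem span_induction {s : Set A} (I : AlgIdeal k A) (hI : ∀ b ∈ s, b ∈ I) {a : A}
    (ha : a ∈ span (k := k) s) : a ∈ I :=
  mem_span.1 ha I hI

/-- The preimage of an ideal under a homomorphism. -/
def comap (f : A →ₙₐ[k] B) (I : AlgIdeal k B) : AlgIdeal k A where
  toSubmodule := I.toSubmodule.comap (f : A →ₗ[k] B)
  mul_mem_left' a b hb := by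
    change f (a * b) ∈ I
    rw [map_mul]
    exact I.mul_mem_left _ hb
  mul_mem_right' a b hb := by
    change f (b * a) ∈ I
    rw [map_mul]
    exact I.mul_mem_right _ hb

theorem mem_comap {f : A →ₙₐ[k] B} {I : AlgIdeal k B} {a : A} : a ∈ comap f I ↔ f a ∈ I :=
  Iff.rfl

variable (k A) in
/-- The zero ideal. -/
def zero : AlgIdeal k A where
  toSubmodule := ⊥
  mul_mem_left' a b hb := by
    obtain rfl : b = 0 := hb
    exact mul_zero a
  mul_mem_right' a b hb := by
    obtain rfl : b = 0 := hb
    exact zero_mul a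

theorem mem_zero {a : A} : a ∈ zero k A ↔ a = 0 := Iff.rfl

theorem map_mem_pow (f : A →ₙₐ[k] B) (I : AlgIdeal k A) (K : AlgIdeal k B)
    (h : ∀ a ∈ I, f a ∈ K) (n : ℕ) {a : A} (ha : a ∈ I.pow (n + 1)) : f a ∈ K.pow (n + 1) := by
  induction n generalizing a with
  | zero => exact h a ha
  | succ n ih =>
    have : I.pow (n + 2) ≤ (K.pow (n + 2)).comap (f : A →ₗ[k] B) := by
      refine Submodule.span_le.2 ?_
      rintro _ ⟨b, hb, c, hc, rfl⟩
      change f (b * c) ∈ K.pow (n + 2)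
      rw [map_mul]
      exact Submodule.subset_span ⟨f b, ih hb, f c, h c hc, rfl⟩
    exact this ha

namespace Quotient

variable (I : AlgIdeal k A)

/-- The canonical projection as a homomorphism of algebras. -/
def mkHom : A →ₙₐ[k] I.Quotient :=
  { mk I with
    map_zero' := map_zero (mk I)
    map_mul' := mk_mul I }

theorem mk_eq_zero {a : A} : mk I a = 0 ↔ a ∈ I := by
  rw [← map_zero (mk I), mk_eq_mk, sub_zero]

variable {I}

/-- The homomorphism induced on a quotient. -/
def lift (f : A →ₙₐ[k] B) (h : ∀ a ∈ I, f a = 0) : I.Quotient →ₙₐ[k] B :=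
  let g : I.Quotient →ₗ[k] B := I.toSubmodule.liftQ (f : A →ₗ[k] B) h
  { g with
    map_zero' := map_zero g
    map_mul' := by
      intro a b
      obtain ⟨a, rfl⟩ := mk_surjective I a
      obtain ⟨b, rfl⟩ := mk_surjective I b
      exact map_mul f a b }

end Quotient

end Basic

end AlgIdeal

section Quasiregular

/-- In the monoid with operation x ∘ y = x + y + xy, an element a is invertible once a ∘ b and c ∘ a
are. This allows quasi-regularity to be tested modulo a quasi-regular ideal. -/
theorem IsQuasiregular.of_circ {R : Type*} [NonUnitalRing R] {a b c : R}
    (h : IsQuasiregular (b + a + a * b)) (h' : IsQuasiregular (a + c + c * a)) :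
    IsQuasiregular a := by
  rw [isQuasiregular_iff'] at *
  have h : IsUnit (PreQuasiregular.equiv a * PreQuasiregular.equiv b) := h
  have h' : IsUnit (PreQuasiregular.equiv c * PreQuasiregular.equiv a) := h'
  obtain ⟨u, hu⟩ := h
  obtain ⟨v, hv⟩ := h'
  refine isUnit_iff_exists_and_exists.2 ⟨⟨PreQuasiregular.equiv b * ↑u⁻¹, ?_⟩,
    ⟨↑v⁻¹ * PreQuasiregular.equiv c, ?_⟩⟩
  · rw [← mul_assoc, ← hu, Units.mul_inv]
  · rw [mul_assoc, ← hv, Units.inv_mul]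

theorem IsQuasiregular.eq_zero_of_idempotent {R : Type*} [NonUnitalRing R] {a : R}
    (h : IsQuasiregular (-a)) (ha : a * a = a) : a = 0 := by
  obtain ⟨b, hb, -⟩ := isQuasiregular_iff.1 h
  -- The quasi-inverse b of -a satisfies b - a - ab = 0; multiplying by a on the left cancels the
  -- terms in b and leaves -a.
  have : a * (b + -a + -a * b) = -a := by
    rw [mul_add, mul_add, mul_neg, ha, neg_mul, mul_neg, ← mul_assoc, ha]
    abel
  rw [hb, mul_zero] at this
  exact neg_eq_zero.1 this.symm

variable {k : Type*} {A B : Type*} [Field k] [NonUnitalRing A] [Module k A]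
  [NonUnitalRing B] [Module k B]

theorem AlgIdeal.isQuasiregular_of_isNilpotent [IsScalarTower k A A] [SMulCommClass k A A]
    {I : AlgIdeal k A} (h : I.IsNilpotent) {a : A} (ha : a ∈ I) : IsQuasiregular a := by
  obtain ⟨t, ht, hI⟩ := h
  have key : ∀ n : ℕ, ∃ b ∈ I.pow (n + 1), (a : Unitization k A) ^ (n + 1) = b := by
    intro n
    induction n with
    | zero => exact ⟨a, ha, by simp⟩
    | succ n ih =>
      obtain ⟨b, hb, hab⟩ := ih
      refine ⟨b * a, Submodule.subset_span ⟨b, hb, a, ha, rfl⟩, ?_⟩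
      rw [pow_succ, hab, Unitization.inr_mul]
  rw [isQuasiregular_iff_isUnit' k]
  refine IsNilpotent.isUnit_one_add ⟨t, ?_⟩
  obtain ⟨n, rfl⟩ := Nat.exists_eq_add_of_le' ht
  obtain ⟨b, hb, hab⟩ := key n
  rw [hI] at hb
  rw [hab, (Submodule.mem_bot k).1 hb, Unitization.inr_zero]

/-- The sum of two quasi-regular ideals is quasi-regular. -/
theorem AlgIdeal.isQuasiregular_add {I K : AlgIdeal k A} (hI : ∀ b ∈ I, IsQuasiregular b)
    (hK : ∀ b ∈ K, IsQuasiregular b) {a b : A} (ha : a ∈ I) (hb : b ∈ K) :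
    IsQuasiregular (a + b) := by
  obtain ⟨c, hc, hc'⟩ := isQuasiregular_iff.1 (hI a ha)
  -- With c the quasi-inverse of a, composing a + b with c on either side cancels a and leaves an
  -- element of K.
  refine IsQuasiregular.of_circ (b := c) (c := c) ?_ ?_
  · have : c + (a + b) + (a + b) * c = b + b * c := by
      rw [add_mul, ← zero_add (b + b * c), ← hc]
      abel
    rw [this]
    exact hK _ (K.toSubmodule.add_mem hb (K.mul_mem_right _ hb))
  · have : a + b + c + c * (a + b) = b + c * b := by
      rw [mul_add, ← zero_add (b + c * b), ← hc']
      abel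
    rw [this]
    exact hK _ (K.toSubmodule.add_mem hb (K.mul_mem_left _ hb))

variable (k A) in
/-- The elements of quasi-regular ideals form an ideal. -/
def quasiregularIdeal : AlgIdeal k A where
  carrier := {a | ∃ I : AlgIdeal k A, a ∈ I ∧ ∀ b ∈ I, IsQuasiregular b}
  zero_mem' := ⟨AlgIdeal.zero k A, rfl, by
    intro b hb
    rw [AlgIdeal.mem_zero.1 hb]
    exact isQuasiregular_iff.2 ⟨0, by simp⟩⟩
  add_mem' := by
    rintro a b ⟨I, ha, hI⟩ ⟨K, hb, hK⟩
    refine ⟨⟨I.toSubmodule ⊔ K.toSubmodule, ?_, ?_⟩, Submodule.add_mem_sup ha hb, ?_⟩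
    · rintro c _ hd
      obtain ⟨d, hI, d', hK, rfl⟩ := Submodule.mem_sup.1 hd
      rw [mul_add]
      exact Submodule.add_mem_sup (I.mul_mem_left c hI) (K.mul_mem_left c hK)
    · rintro c _ hd
      obtain ⟨d, hI, d', hK, rfl⟩ := Submodule.mem_sup.1 hd
      rw [add_mul]
      exact Submodule.add_mem_sup (I.mul_mem_right c hI) (K.mul_mem_right c hK)
    · intro _ hd
      obtain ⟨d, hdI, d', hdK, rfl⟩ := Submodule.mem_sup.1 hd
      exact AlgIdeal.isQuasiregular_add hI hK hdI hdK
  smul_mem' := by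
    rintro c a ⟨I, ha, hI⟩
    exact ⟨I, I.toSubmodule.smul_mem c ha, hI⟩
  mul_mem_left' := by
    rintro a b ⟨I, hb, hI⟩
    exact ⟨I, I.mul_mem_left a hb, hI⟩
  mul_mem_right' := by
    rintro a b ⟨I, hb, hI⟩
    exact ⟨I, I.mul_mem_right a hb, hI⟩

theorem mem_jacobsonRadical_of_mem {I : AlgIdeal k A} (hI : ∀ b ∈ I, IsQuasiregular b) {a : A}
    (ha : a ∈ I) : a ∈ jacobsonRadical k A :=
  AlgIdeal.subset_span ⟨I, ha, hI⟩

/-- Sums of quasi-regular ideals are quasi-regular, so the set generating the radical is already an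
ideal, and the radical is itself quasi-regular. -/
theorem isQuasiregular_of_mem_jacobsonRadical {a : A} (ha : a ∈ jacobsonRadical k A) :
    IsQuasiregular a := by
  obtain ⟨I, ha, hI⟩ := AlgIdeal.span_induction (quasiregularIdeal k A) (fun _ h => h) ha
  exact hI a ha

theorem eq_zero_of_mem_jacobsonRadical_of_idempotent {a : A} (ha : a ∈ jacobsonRadical k A)
    (h : a * a = a) : a = 0 :=
  (isQuasiregular_of_mem_jacobsonRadical
    ((jacobsonRadical k A).neg_mem ha)).eq_zero_of_idempotent h

/-- A quasi-regular ideal of `A / r(A)` is zero. -/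
theorem eq_zero_of_mem_quasiregular_quotient_radical
    {I : AlgIdeal k (jacobsonRadical k A).Quotient} (hI : ∀ b ∈ I, IsQuasiregular b)
    {a : (jacobsonRadical k A).Quotient} (ha : a ∈ I) : a = 0 := by
  obtain ⟨a, rfl⟩ := AlgIdeal.Quotient.mk_surjective _ a
  rw [AlgIdeal.Quotient.mk_eq_zero]
  refine mem_jacobsonRadical_of_mem
    (I := AlgIdeal.comap (AlgIdeal.Quotient.mkHom (jacobsonRadical k A)) I) ?_ ha
  intro b hb
  have hb : AlgIdeal.Quotient.mk _ b ∈ I := hb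
  obtain ⟨c, hc, hc'⟩ := isQuasiregular_iff.1 (hI _ hb)
  obtain ⟨c, rfl⟩ := AlgIdeal.Quotient.mk_surjective _ c
  rw [← AlgIdeal.Quotient.mk_mul, ← map_add, ← map_add,
    AlgIdeal.Quotient.mk_eq_zero] at hc hc'
  -- A quasi-inverse modulo the radical makes both circle products elements of the radical, hence
  -- quasi-regular. Thus the preimage of `I` is a quasi-regular ideal of `A`.
  exact IsQuasiregular.of_circ (isQuasiregular_of_mem_jacobsonRadical hc)
    (isQuasiregular_of_mem_jacobsonRadical hc')

end Quasiregular

/-! ## Decompositions into direct sums and central idempotents -/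

section Decomposition

variable {k : Type*} {R : Type*} [Field k] [NonUnitalRing R] [Module k R]

namespace IsAlgDirectSum

variable {n : ℕ} {B : Fin n → NonUnitalSubalgebra k R}

theorem exists_sum_eq (hB : IsAlgDirectSum B) (a : R) : ∃ b : ∀ i, B i, ∑ i, (b i : R) = a := by
  have h : a ∈ ⨆ i, (B i).toSubmodule := by
    rw [hB.1.submodule_iSup_eq_top]
    trivial
  induction h using Submodule.iSup_induction' with
  | mem i a ha =>
    refine ⟨Pi.single i ⟨a, ha⟩, ?_⟩
    rw [Finset.sum_eq_single i]
    · rw [Pi.single_eq_same]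
    · intro j _ hj
      rw [Pi.single_eq_of_ne hj]
      rfl
    · simp
  | zero => exact ⟨0, by simp⟩
  | add a a' _ _ h h' =>
    obtain ⟨b, rfl⟩ := h
    obtain ⟨b', rfl⟩ := h'
    exact ⟨b + b', by simp [Finset.sum_add_distrib]⟩

theorem mul_sum (hB : IsAlgDirectSum B) (i : Fin n) (c : B i) (b : ∀ j, B j) :
    (c : R) * ∑ j, (b j : R) = c * b i := by
  rw [Finset.mul_sum, Finset.sum_eq_single i]
  · intro j _ hj
    exact hB.2 i j hj.symm _ c.2 _ (b j).2
  · simp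

theorem sum_mul (hB : IsAlgDirectSum B) (i : Fin n) (c : B i) (b : ∀ j, B j) :
    (∑ j, (b j : R)) * c = b i * c := by
  rw [Finset.sum_mul, Finset.sum_eq_single i]
  · intro j _ hj
    exact hB.2 j i hj _ (b j).2 _ c.2
  · simp

/-- The components of the unity element are unity elements of the summands. -/
theorem exists_units (hB : IsAlgDirectSum B) {u : R} (hu : ∀ a, u * a = a ∧ a * u = a) :
    ∃ c : ∀ i, B i, ∑ i, (c i : R) = u ∧ (∀ i (a : B i), c i * a = a) ∧
      ∀ i (a : B i), a * c i = a := by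
  obtain ⟨c, hc⟩ := hB.exists_sum_eq u
  refine ⟨c, hc, fun i a => Subtype.ext ?_, fun i a => Subtype.ext ?_⟩
  · have := hB.sum_mul i a c
    rw [hc, (hu _).1] at this
    exact this.symm
  · have := hB.mul_sum i a c
    rw [hc, (hu _).2] at this
    exact this.symm

variable {c : ∀ i, B i}

theorem unit_mul_sum (hB : IsAlgDirectSum B) (hc : ∀ i (a : B i), c i * a = a) (b : ∀ j, B j)
    (i : Fin n) : (c i : R) * ∑ j, (b j : R) = b i := by
  rw [hB.mul_sum]
  exact congrArg Subtype.val (hc i (b i))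

theorem unit_mul_mem (hB : IsAlgDirectSum B) (hc : ∀ i (a : B i), c i * a = a) (i : Fin n)
    (a : R) : (c i : R) * a ∈ B i := by
  obtain ⟨b, rfl⟩ := hB.exists_sum_eq a
  rw [hB.unit_mul_sum hc]
  exact (b i).2

theorem unit_mul_comm (hB : IsAlgDirectSum B) (hc : ∀ i (a : B i), c i * a = a)
    (hc' : ∀ i (a : B i), a * c i = a) (i : Fin n) (a : R) : (c i : R) * a = a * c i := by
  obtain ⟨b, rfl⟩ := hB.exists_sum_eq a
  rw [hB.unit_mul_sum hc, hB.sum_mul]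
  exact (congrArg Subtype.val (hc' i (b i))).symm

theorem eq_zero_of_sum_eq_zero (hB : IsAlgDirectSum B) (hc : ∀ i (a : B i), c i * a = a)
    {b : ∀ j, B j} (h : ∑ j, (b j : R) = 0) : b = 0 := by
  funext i
  have := hB.unit_mul_sum hc b i
  rw [h, mul_zero] at this
  exact Subtype.ext this.symm

end IsAlgDirectSum

variable (k) in
/-- The elements fixed by multiplication with `c` on the left. -/
def cornerSubalgebra [SMulCommClass k R R] (c : R) : NonUnitalSubalgebra k R where
  carrier := {a | c * a = a}
  zero_mem' := mul_zero c
  add_mem' := by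
    intro a b (ha : c * a = a) (hb : c * b = b)
    change c * (a + b) = a + b
    rw [mul_add, ha, hb]
  mul_mem' := by
    intro a b (ha : c * a = a) _
    change c * (a * b) = a * b
    rw [← mul_assoc, ha]
  smul_mem' := by
    intro d a (ha : c * a = a)
    change c * (d • a) = d • a
    rw [mul_smul_comm, ha]

variable [SMulCommClass k R R]

theorem mem_cornerSubalgebra {c a : R} : a ∈ cornerSubalgebra k c ↔ c * a = a := Iff.rfl

/-- This is the Peirce decomposition for central orthogonal elements whose sum acts as unity on the
left; their idempotence is a consequence. -/
theorem isAlgDirectSum_cornerSubalgebra {n : ℕ} {c : Fin n → R}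
    (hc : ∀ i a, c i * a = a * c i) (ho : ∀ i j, i ≠ j → c i * c j = 0)
    (hs : ∀ a, (∑ i, c i) * a = a) : IsAlgDirectSum fun i => cornerSubalgebra k (c i) := by
  have hi : ∀ i a, c i * (c i * a) = c i * a := by
    intro i a
    have := hs (c i * a)
    rw [Finset.sum_mul, Finset.sum_eq_single i] at this
    · exact this
    · intro j _ hj
      rw [← mul_assoc, ho j i hj, zero_mul]
    · simp
  refine ⟨?_, ?_⟩
  · rw [DirectSum.isInternal_submodule_iff_iSupIndep_and_iSup_eq_top]
    constructor
    · intro i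
      rw [Submodule.disjoint_def]
      intro a (ha : c i * a = a) ha'
      -- Multiplication by `c i` kills all the other summands and fixes its own, so they meet in
      -- zero.
      have hle : ⨆ j, ⨆ (_ : j ≠ i), (cornerSubalgebra k (c j)).toSubmodule ≤
          LinearMap.ker (LinearMap.mulLeft k (c i)) := by
        refine iSup₂_le fun j hj b (hb : c j * b = b) => ?_
        rw [LinearMap.mem_ker, LinearMap.mulLeft_apply, ← hb, ← mul_assoc, ho i j hj.symm,
          zero_mul]
      have := hle ha'
      rw [LinearMap.mem_ker, LinearMap.mulLeft_apply, ha] at this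
      exact this
    · rw [eq_top_iff]
      intro a _
      rw [← hs a, Finset.sum_mul]
      refine Submodule.sum_mem _ fun i _ => Submodule.mem_iSup_of_mem i ?_
      exact hi i a
  · intro i j hij a (ha : c i * a = a) b (hb : c j * b = b)
    rw [← ha, ← hb, hc i a, mul_assoc, ← mul_assoc (c i), ho i j hij, zero_mul, mul_zero]

/-- Summands of a decomposition can be grouped together. -/
theorem IsAlgDirectSum.exists_of_le [IsScalarTower k R R] {n m : ℕ}
    {B : Fin n → NonUnitalSubalgebra k R}
    (hB : IsAlgDirectSum B) (h0 : ∀ i, B i ≠ ⊥) {u : R} (hu : ∀ a, u * a = a ∧ a * u = a)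
    (hm : 1 ≤ m) (hmn : m ≤ n) :
    ∃ B' : Fin m → NonUnitalSubalgebra k R, IsAlgDirectSum B' ∧ ∀ i, B' i ≠ ⊥ := by
  obtain ⟨c, hcu, hc, hc'⟩ := hB.exists_units hu
  have ho : ∀ i j, i ≠ j → (c i : R) * c j = 0 := fun i j hij =>
    hB.2 i j hij _ (c i).2 _ (c j).2
  -- All indices from m - 1 on go into the last block. Each i < m stays in block i, so no block is
  -- empty.
  let g : Fin n → Fin m := fun j => ⟨min j (m - 1), by omega⟩
  have hg : ∀ i : Fin m, g ⟨i, by omega⟩ = i := fun i =>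
    Fin.ext (min_eq_left (Nat.le_sub_one_of_lt i.2))
  let d : Fin m → R := fun i => ∑ j with g j = i, (c j : R)
  have hdc : ∀ i : Fin m, d i * (c ⟨i, by omega⟩ : R) = c ⟨i, by omega⟩ := by
    intro i
    change (∑ j with g j = i, (c j : R)) * _ = _
    rw [Finset.sum_mul, Finset.sum_eq_single ⟨i, by omega⟩]
    · exact congrArg Subtype.val (hc _ (c _))
    · intro j _ hj
      exact ho _ _ hj
    · intro h
      refine absurd ?_ h
      rw [Finset.mem_filter]
      exact ⟨Finset.mem_univ _, hg i⟩
  refine ⟨fun i => cornerSubalgebra k (d i), isAlgDirectSum_cornerSubalgebra ?_ ?_ ?_, ?_⟩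
  · intro i a
    rw [Finset.sum_mul, Finset.mul_sum]
    exact Finset.sum_congr rfl fun j _ => hB.unit_mul_comm hc hc' j a
  · intro i j hij
    rw [Finset.sum_mul]
    refine Finset.sum_eq_zero fun l hl => ?_
    rw [Finset.mul_sum]
    refine Finset.sum_eq_zero fun l' hl' => ho _ _ ?_
    rintro rfl
    exact hij ((Finset.mem_filter.1 hl).2.symm.trans (Finset.mem_filter.1 hl').2)
  · intro a
    rw [Finset.sum_fiberwise, hcu, (hu a).1]
  · intro i h
    have hmem : (c ⟨i, by omega⟩ : R) ∈ cornerSubalgebra k (d i) := by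
      rw [mem_cornerSubalgebra, hdc]
    have h : cornerSubalgebra k (d i) = ⊥ := h
    rw [h, NonUnitalAlgebra.mem_bot] at hmem
    apply h0 ⟨i, by omega⟩
    rw [eq_bot_iff]
    intro a ha
    have := congrArg Subtype.val (hc ⟨i, by omega⟩ ⟨a, ha⟩)
    rw [NonUnitalAlgebra.mem_bot]
    refine this.symm.trans ?_
    change (c ⟨i, by omega⟩ : R) * a = 0
    rw [hmem, zero_mul]

end Decomposition

/-! ## Existence of the Wedderburn–Artin decomposition -/

section WedderburnArtin

/-- The isomorphism with a product of matrix rings is one of rings and need not be `k`-linear. The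
summands are therefore cut out by the central idempotents of the blocks, which yields `k`-subspaces.
-/
theorem IsSemisimpleRing.exists_isAlgDirectSum (k : Type*) {R : Type*} [Field k] [Ring R]
    [Module k R] [SMulCommClass k R R] [IsSemisimpleRing R] :
    ∃ (n : ℕ) (B : Fin n → NonUnitalSubalgebra k R),
      IsAlgDirectSum B ∧ ∀ i, IsSimpleRing (B i) := by
  obtain ⟨n, D, d, _, hd, ⟨f⟩⟩ := IsSemisimpleRing.exists_ringEquiv_pi_matrix_divisionRing R
  let c : Fin n → R := fun i => f.symm (Pi.single i 1)
  refine ⟨n, fun i => cornerSubalgebra k (c i), isAlgDirectSum_cornerSubalgebra ?_ ?_ ?_, ?_⟩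
  · intro i a
    obtain ⟨a, rfl⟩ := f.symm.surjective a
    rw [← map_mul, ← map_mul]
    congr 1
    funext j
    by_cases hj : j = i
    · subst hj; simp
    · simp [Pi.single_eq_of_ne hj]
  · intro i j hij
    rw [← map_mul, ← map_zero f.symm]
    congr 1
    funext l
    by_cases hl : l = i
    · subst hl; simp [Pi.single_eq_of_ne hij]
    · simp [Pi.single_eq_of_ne hl]
  · intro a
    have := Finset.univ_sum_single (1 : ∀ i, Matrix (Fin (d i)) (Fin (d i)) (D i))
    simp only [Pi.one_apply] at this
    rw [← map_sum, this, map_one, one_mul]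
  · intro i
    have hmem : ∀ a, a ∈ cornerSubalgebra k (c i) ↔ Pi.single i (f a i) = f a := by
      intro a
      rw [mem_cornerSubalgebra, ← f.injective.eq_iff, map_mul, f.apply_symm_apply,
        ← Pi.single_mul_left, one_mul]
    let g : Matrix (Fin (d i)) (Fin (d i)) (D i) ≃+* cornerSubalgebra k (c i) :=
      { toFun := fun m => ⟨f.symm (Pi.single i m), (hmem _).2 (by simp)⟩
        invFun := fun a => f a i
        left_inv := fun m => by simp
        right_inv := fun a => Subtype.ext (by
          change f.symm (Pi.single i (f a i)) = a
          rw [(hmem _).1 a.2, f.symm_apply_apply])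
        map_mul' := fun a b => Subtype.ext (by
          change f.symm _ = f.symm _ * f.symm _
          rw [← map_mul, Pi.single_mul])
        map_add' := fun a b => Subtype.ext (by
          change f.symm _ = f.symm _ + f.symm _
          rw [← map_add, Pi.single_add]) }
    have := hd i
    exact IsSimpleRing.of_ringEquiv g inferInstance

/-- The Jacobson radical of an artinian ring is nilpotent, hence one of the nil ideals assumed to
vanish. -/
theorem IsArtinianRing.isSemisimpleRing_of_nil {R : Type*} [Ring R] [IsArtinianRing R]
    (h : ∀ I : Ideal R, I.IsTwoSided → (∀ a ∈ I, IsNilpotent a) → I = ⊥) :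
    IsSemisimpleRing R := by
  rw [IsArtinianRing.isSemisimpleRing_iff_jacobson]
  refine h _ inferInstance fun a ha => ?_
  obtain ⟨n, hn⟩ := IsSemiprimaryRing.isNilpotent (R := R)
  refine ⟨n, ?_⟩
  have := Ideal.pow_mem_pow ha n
  rw [hn] at this
  exact this

variable {k : Type*} {R : Type*} [Field k]

/-- In the presence of a unity, c • a = (c • 1) a, so ring ideals are automatically `k`-subspaces
and the chain condition transfers. -/
theorem IsLeftArtinianAlg.isArtinianRing [Ring R] [Module k R] [IsScalarTower k R R]
    (h : IsLeftArtinianAlg k R) : IsArtinianRing R := by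
  have h : WellFoundedLT {L : Submodule k R // ∀ a : R, ∀ b ∈ L, a * b ∈ L} := h
  let F : Submodule R R → {L : Submodule k R // ∀ a : R, ∀ b ∈ L, a * b ∈ L} := fun L =>
    ⟨{ L.toAddSubmonoid with
        smul_mem' := fun c a ha => by
          rw [← smul_one_mul c a]
          exact L.smul_mem _ ha }, fun a b hb => L.smul_mem a hb⟩
  have hF : StrictMono F := fun L L' hL => hL
  exact hF.wellFoundedLT

theorem IsRightArtinianAlg.isArtinianRing [Ring R] [Module k R] [SMulCommClass k R R]
    (h : IsRightArtinianAlg k R) : IsArtinianRing Rᵐᵒᵖ := by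
  have h : WellFoundedLT {L : Submodule k R // ∀ a : R, ∀ b ∈ L, b * a ∈ L} := h
  let F : Submodule Rᵐᵒᵖ Rᵐᵒᵖ → {L : Submodule k R // ∀ a : R, ∀ b ∈ L, b * a ∈ L} := fun L =>
    ⟨{ carrier := {a | MulOpposite.op a ∈ L}
       zero_mem' := L.zero_mem
       add_mem' := fun ha hb => L.add_mem ha hb
       smul_mem' := fun c a ha => by
          change MulOpposite.op (c • a) ∈ L
          rw [← mul_smul_one c a]
          exact L.smul_mem (MulOpposite.op (c • 1)) ha },
      fun a b hb => L.smul_mem (MulOpposite.op a) hb⟩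
  have hF : StrictMono F := by
    intro L L' hL
    refine ⟨fun a ha => hL.1 ha, fun hle => hL.2 fun a ha => ?_⟩
    have hle : ∀ b : R, MulOpposite.op b ∈ L' → MulOpposite.op b ∈ L := hle
    exact hle a.unop ha
  exact hF.wellFoundedLT

theorem IsArtinianAlg.isSemisimpleRing [Ring R] [Module k R] [IsScalarTower k R R]
    [SMulCommClass k R R] (h : IsArtinianAlg k R)
    (h0 : ∀ I : AlgIdeal k R, (∀ b ∈ I, IsQuasiregular b) → ∀ a ∈ I, a = 0) :
    IsSemisimpleRing R := by
  rcases h with h | h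
  · have := h.isArtinianRing
    refine IsArtinianRing.isSemisimpleRing_of_nil fun I _ hI => ?_
    rw [eq_bot_iff]
    refine h0
      { I.toAddSubmonoid with
        smul_mem' := fun c a ha => by
          rw [← smul_one_mul c a]
          exact I.smul_mem _ ha
        mul_mem_left' := fun a b hb => I.mul_mem_left a hb
        mul_mem_right' := fun a b hb => I.mul_mem_right a hb } ?_
    exact fun b hb => isQuasiregular_iff_isUnit.2 (hI b hb).isUnit_one_add
  · have := h.isArtinianRing
    -- Semisimplicity is left-right symmetric, so the right artinian case is settled in the opposite
    -- ring.
    rw [← isSemisimpleRing_mulOpposite_iff]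
    refine IsArtinianRing.isSemisimpleRing_of_nil fun I _ hI => ?_
    rw [eq_bot_iff]
    intro a ha
    refine MulOpposite.unop_injective (h0
      { carrier := {a | MulOpposite.op a ∈ I}
        zero_mem' := I.zero_mem
        add_mem' := fun ha hb => I.add_mem ha hb
        smul_mem' := fun c a ha => by
          change MulOpposite.op (c • a) ∈ I
          rw [← mul_smul_one c a]
          exact I.smul_mem (MulOpposite.op (c • 1)) ha
        mul_mem_left' := fun a b hb => I.mul_mem_right (MulOpposite.op a) hb
        mul_mem_right' := fun a b hb => I.mul_mem_left (MulOpposite.op a) hb } ?_ a.unop ha)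
    intro b hb
    have hb : MulOpposite.op b ∈ I := hb
    obtain ⟨n, hn⟩ := hI _ hb
    have hn : b ^ n = 0 := MulOpposite.op_injective hn
    exact isQuasiregular_iff_isUnit.2 (IsNilpotent.isUnit_one_add ⟨n, hn⟩)

theorem IsArtinianAlg.exists_isAlgDirectSum [NonUnitalRing R] [Module k R] [IsScalarTower k R R]
    [SMulCommClass k R R] (h : IsArtinianAlg k R)
    (h0 : ∀ I : AlgIdeal k R, (∀ b ∈ I, IsQuasiregular b) → ∀ a ∈ I, a = 0) {u : R}
    (hu : ∀ a, u * a = a ∧ a * u = a) :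
    ∃ (n : ℕ) (B : Fin n → NonUnitalSubalgebra k R),
      IsAlgDirectSum B ∧ ∀ i, IsSimpleRing (B i) := by
  let _ : Ring R :=
    { (inferInstance : NonUnitalRing R) with
      one := u
      one_mul := fun a => (hu a).1
      mul_one := fun a => (hu a).2 }
  have := h.isSemisimpleRing h0
  exact IsSemisimpleRing.exists_isAlgDirectSum k

end WedderburnArtin

/-! ## Homomorphisms out of generalized path algebras -/

namespace OmegaPath

variable {k : Type y} [Field k] {I : Type u} {D : I → I → Type v} {Ω : I → Type w}
  [∀ i, NonUnitalRing (Ω i)] [∀ i, Module k (Ω i)]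
  {A : Type x} [NonUnitalRing A] [Module k A]

/-- The value of a path in an algebra `A`, given values for its entries and arrows. -/
def eval (σ : ∀ i, Ω i →ₙₐ[k] A) (θ : ∀ i j, D i j → A) :
    ∀ {i j : I}, OmegaPath D Ω i j → A
  | i, _, nil a => σ i a
  | i, _, cons (j := j) a x p => σ i a * (θ i j x * eval σ θ p)

variable {σ : ∀ i, Ω i →ₙₐ[k] A} {θ : ∀ i j, D i j → A}

theorem eval_lmul {i j : I} (a : Ω i) (p : OmegaPath D Ω i j) :
    eval σ θ (lmul a p) = σ i a * eval σ θ p := by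
  cases p with
  | nil b => exact map_mul (σ _) a b
  | cons b x p =>
    change σ _ (a * b) * _ = σ _ a * (σ _ b * _)
    rw [map_mul, mul_assoc]

theorem eval_comp {i j l : I} (p : OmegaPath D Ω i j) (q : OmegaPath D Ω j l) :
    eval σ θ (comp p q) = eval σ θ p * eval σ θ q := by
  induction p with
  | nil a => exact eval_lmul a q
  | cons a x p ih =>
    change σ _ a * (θ _ _ x * eval σ θ (comp p q)) = σ _ a * (θ _ _ x * eval σ θ p) * _
    rw [ih, mul_assoc, mul_assoc]

theorem mul_eval_of_ne (hσ : ∀ i j, i ≠ j → ∀ a b, σ i a * σ j b = 0) {i j l : I} (h : l ≠ i)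
    (a : Ω l) (p : OmegaPath D Ω i j) : σ l a * eval σ θ p = 0 := by
  cases p with
  | nil b => exact hσ _ _ h a b
  | cons b x p =>
    change σ l a * (σ i b * _) = 0
    rw [← mul_assoc, hσ _ _ h, zero_mul]

theorem eval_mul_eval_of_ne (hσ : ∀ i j, i ≠ j → ∀ a b, σ i a * σ j b = 0) {i j i' j' : I}
    (h : j ≠ i') (p : OmegaPath D Ω i j) (q : OmegaPath D Ω i' j') :
    eval σ θ p * eval σ θ q = 0 := by
  induction p with
  | nil a => exact mul_eval_of_ne hσ h a q
  | cons a x p ih =>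
    change σ _ a * (θ _ _ x * eval σ θ p) * _ = 0
    rw [mul_assoc, mul_assoc, ih h, mul_zero, mul_zero]

theorem LinRel.eval_eq [IsScalarTower k A A] [SMulCommClass k A A] {c d : k} {i j : I}
    {p q s : OmegaPath D Ω i j} (h : LinRel c d p q s) :
    eval σ θ s = c • eval σ θ p + d • eval σ θ q := by
  induction h with
  | nil a b =>
    change σ _ _ = c • σ _ a + d • σ _ b
    rw [map_add, map_smul, map_smul]
  | head a b x p =>
    change σ _ _ * _ = c • (σ _ a * _) + d • (σ _ b * _)
    rw [map_add, map_smul, map_smul, add_mul, smul_mul_assoc, smul_mul_assoc]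
  | tail a x h ih =>
    change σ _ _ * (θ _ _ x * _) = c • (σ _ a * (θ _ _ x * _)) + d • (σ _ a * (θ _ _ x * _))
    rw [ih, mul_add, mul_add, mul_smul_comm, mul_smul_comm, mul_smul_comm, mul_smul_comm]

end OmegaPath

/-- The value of a word: the zero symbol has value zero. -/
def OmegaWord.eval {k : Type y} [Field k] {I : Type u} {D : I → I → Type v} {Ω : I → Type w}
    [∀ i, NonUnitalRing (Ω i)] [∀ i, Module k (Ω i)] {A : Type x} [NonUnitalRing A] [Module k A]
    (σ : ∀ i, Ω i →ₙₐ[k] A) (θ : ∀ i j, D i j → A) : OmegaWord D Ω → A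
  | zero => 0
  | path p => p.eval σ θ

namespace GenPathAlgebra

section Lift

variable {k : Type y} [Field k] {I : Type u} {D : I → I → Type v} {Ω : I → Type w}
  [∀ i, NonUnitalRing (Ω i)] [∀ i, Module k (Ω i)]
  {A : Type x} [NonUnitalRing A] [Module k A] [IsScalarTower k A A] [SMulCommClass k A A]

/-- The homomorphism from the algebra of words that is given by values of entries and arrows. -/
noncomputable def wordLift (σ : ∀ i, Ω i →ₙₐ[k] A) (hσ : ∀ i j, i ≠ j → ∀ a b, σ i a * σ j b = 0)
    (θ : ∀ i j, D i j → A) : MonoidAlgebra k (OmegaWord D Ω) →ₙₐ[k] A :=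
  MonoidAlgebra.liftMagma k
    { toFun := OmegaWord.eval σ θ
      map_mul' := by
        intro p q
        cases p with
        | zero => rw [OmegaWord.zero_mul']; exact (zero_mul _).symm
        | @path i j p =>
        cases q with
        | zero => rw [OmegaWord.mul_zero']; exact (mul_zero _).symm
        | @path i' j' q =>
        by_cases h : j = i'
        · subst h
          rw [OmegaWord.path_mul_path]
          exact OmegaPath.eval_comp p q
        · rw [OmegaWord.path_mul_path_of_ne h]
          exact (OmegaPath.eval_mul_eval_of_ne hσ h p q).symm }

variable {σ : ∀ i, Ω i →ₙₐ[k] A} (hσ : ∀ i j, i ≠ j → ∀ a b, σ i a * σ j b = 0)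
  {θ : ∀ i j, D i j → A}

theorem wordLift_single (p : OmegaWord D Ω) :
    wordLift σ hσ θ (MonoidAlgebra.single p 1) = p.eval σ θ := by
  simp [wordLift]

theorem wordLift_eq_zero {f : MonoidAlgebra k (OmegaWord D Ω)} (hf : f ∈ omegaRelations k D Ω) :
    wordLift σ hσ θ f = 0 := by
  refine AlgIdeal.span_induction (AlgIdeal.comap (wordLift σ hσ θ) (AlgIdeal.zero k A)) ?_ hf
  rintro _ (rfl | ⟨c, d, i, j, p, q, s, h, rfl⟩)
  · exact wordLift_single hσ _
  · change wordLift σ hσ θ _ = 0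
    rw [map_sub, map_sub, map_smul, map_smul, wordLift_single, wordLift_single,
      wordLift_single]
    change OmegaPath.eval σ θ s - c • OmegaPath.eval σ θ p - d • OmegaPath.eval σ θ q = 0
    rw [h.eval_eq]
    abel

/-- The homomorphism `k(D, Ω) → A` that is given by values of entries and arrows. -/
noncomputable def lift (σ : ∀ i, Ω i →ₙₐ[k] A) (hσ : ∀ i j, i ≠ j → ∀ a b, σ i a * σ j b = 0)
    (θ : ∀ i j, D i j → A) : GenPathAlgebra k D Ω →ₙₐ[k] A :=
  AlgIdeal.Quotient.lift (wordLift σ hσ θ) fun _ => wordLift_eq_zero hσ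

theorem lift_ofPath {i j : I} (p : OmegaPath D Ω i j) :
    lift σ hσ θ (ofPath k D p) = p.eval σ θ := wordLift_single hσ _

end Lift

section Paths

variable (k : Type y) [Field k] {I : Type u} (D : I → I → Type v) {Ω : I → Type w}
  [∀ i, NonUnitalRing (Ω i)] [∀ i, Module k (Ω i)]

theorem ofPath_mul_ofPath {i j l : I} (p : OmegaPath D Ω i j) (q : OmegaPath D Ω j l) :
    ofPath k D p * ofPath k D q = ofPath k D (p.comp q) := by
  rw [ofPath, ofPath, ← AlgIdeal.Quotient.mk_mul, MonoidAlgebra.single_mul_single, mul_one,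
    OmegaWord.path_mul_path]
  rfl

theorem ofPath_mul_ofPath_of_ne {i j j' l : I} (h : j ≠ j') (p : OmegaPath D Ω i j)
    (q : OmegaPath D Ω j' l) : ofPath k D p * ofPath k D q = 0 := by
  rw [ofPath, ofPath, ← AlgIdeal.Quotient.mk_mul, MonoidAlgebra.single_mul_single, mul_one,
    OmegaWord.path_mul_path_of_ne h, AlgIdeal.Quotient.mk_eq_zero]
  exact AlgIdeal.subset_span (Or.inl rfl)

theorem ofPath_of_linRel {c d : k} {i j : I} {p q s : OmegaPath D Ω i j}
    (h : OmegaPath.LinRel c d p q s) :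
    ofPath k D s = c • ofPath k D p + d • ofPath k D q := by
  rw [← sub_eq_zero, ← sub_sub]
  rw [ofPath, ofPath, ofPath, ← map_smul, ← map_smul, ← map_sub, ← map_sub,
    AlgIdeal.Quotient.mk_eq_zero]
  exact AlgIdeal.subset_span (Or.inr ⟨c, d, i, j, p, q, s, h, rfl⟩)

variable {k D}

/-- The paths span, since the zero symbol has class zero; linear claims need checking only on paths.
-/
theorem mem_of_forall_ofPath_mem (N : Submodule k (GenPathAlgebra k D Ω))
    (h : ∀ (i j : I) (p : OmegaPath D Ω i j), ofPath k D p ∈ N) (a : GenPathAlgebra k D Ω) :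
    a ∈ N := by
  obtain ⟨f, rfl⟩ := AlgIdeal.Quotient.mk_surjective _ a
  induction f using MonoidAlgebra.induction_linear with
  | zero => rw [map_zero]; exact N.zero_mem
  | add f g hf hg => rw [map_add]; exact N.add_mem hf hg
  | single p c =>
    have : (MonoidAlgebra.single p c : MonoidAlgebra k (OmegaWord D Ω)) =
        c • MonoidAlgebra.single p 1 := by simp
    rw [this, map_smul]
    refine N.smul_mem c ?_
    cases p with
    | zero =>
      have h0 : AlgIdeal.Quotient.mk (omegaRelations k D Ω)
          (MonoidAlgebra.single OmegaWord.zero 1) = 0 :=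
        (AlgIdeal.Quotient.mk_eq_zero _).2 (AlgIdeal.subset_span (Or.inl rfl))
      rw [h0]
      exact N.zero_mem
    | path p => exact h _ _ p

variable (k D) in
/-- The embedding of a vertex algebra into `k(D, Ω)`. -/
noncomputable def vertexMap (i : I) : Ω i →ₗ[k] GenPathAlgebra k D Ω where
  toFun a := ofPath k D (OmegaPath.nil a)
  map_add' a b := by
    have := ofPath_of_linRel k D (OmegaPath.LinRel.nil (D := D) (c := (1 : k)) (d := 1) a b)
    simpa only [one_smul] using this
  map_smul' c a := by
    have := ofPath_of_linRel k D (OmegaPath.LinRel.nil (D := D) (c := c) (d := 0) a a)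
    rw [zero_smul, add_zero, zero_smul, add_zero] at this
    exact this

theorem vertexMap_apply {i : I} (a : Ω i) : vertexMap k D i a = ofPath k D (OmegaPath.nil a) :=
  rfl

/-- A path with at least one arrow lies in the ideal generated by the arrows. -/
theorem ofPath_cons_mem {e : ∀ i, Ω i} (he : IsVertexSystem k e) {i j l : I} (a : Ω i)
    (x : D i j) (p : OmegaPath D Ω j l) :
    ofPath k D (OmegaPath.cons a x p) ∈ arrowIdeal k D e := by
  have : ofPath k D (OmegaPath.cons a x p) = ofPath k D (OmegaPath.nil a) *
      ofPath k D (OmegaPath.cons (e i) x (OmegaPath.nil (e j))) * ofPath k D p := by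
    rw [ofPath_mul_ofPath, ofPath_mul_ofPath]
    have hp : OmegaPath.lmul (e j) p = p := by
      cases p <;> simp [OmegaPath.lmul, he.e_mul]
    change _ = ofPath k D (OmegaPath.cons (a * e i) x (OmegaPath.lmul (e j) p))
    rw [he.mul_e, hp]
  rw [this]
  exact AlgIdeal.mul_mem_right _ _ (AlgIdeal.mul_mem_left _ _
    (AlgIdeal.subset_span ⟨i, j, x, rfl⟩))

/-- Only paths from i to j survive between the two vertex elements, and as i ≠ j these have at least
one arrow. -/
theorem vertex_mul_mul_vertex_mem {e : ∀ i, Ω i} (he : IsVertexSystem k e) {i j : I} (h : i ≠ j)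
    (a : Ω i) (b : Ω j) (z : GenPathAlgebra k D Ω) :
    vertexMap k D i a * z * vertexMap k D j b ∈ arrowIdeal k D e := by
  have := mem_of_forall_ofPath_mem (k := k) (D := D) (Ω := Ω)
    { carrier := {z | vertexMap k D i a * z * vertexMap k D j b ∈ arrowIdeal k D e}
      zero_mem' := by
        change _ * 0 * _ ∈ arrowIdeal k D e
        rw [mul_zero, zero_mul]
        exact (arrowIdeal k D e).toSubmodule.zero_mem
      add_mem' := fun {z z'} hz hz' => by
        change _ * (z + z') * _ ∈ arrowIdeal k D e
        rw [mul_add, add_mul]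
        exact (arrowIdeal k D e).toSubmodule.add_mem hz hz'
      smul_mem' := fun c z hz => by
        change _ * (c • z) * _ ∈ arrowIdeal k D e
        rw [mul_smul_comm, smul_mul_assoc]
        exact (arrowIdeal k D e).toSubmodule.smul_mem c hz } ?_ z
  · exact this
  · intro i' j' p
    change vertexMap k D i a * ofPath k D p * vertexMap k D j b ∈ arrowIdeal k D e
    rw [vertexMap_apply, vertexMap_apply]
    by_cases hi : i = i'
    · subst hi
      rw [ofPath_mul_ofPath]
      by_cases hj : j' = j
      · subst hj
        cases p with
        | nil => exact absurd rfl h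
        | cons c x p =>
          rw [ofPath_mul_ofPath]
          exact ofPath_cons_mem he _ _ _
      · rw [ofPath_mul_ofPath_of_ne k D hj]
        exact (arrowIdeal k D e).toSubmodule.zero_mem
    · rw [ofPath_mul_ofPath_of_ne k D hi, zero_mul]
      exact (arrowIdeal k D e).toSubmodule.zero_mem

/-- Modulo the arrows, every element is a sum of vertex elements. -/
theorem exists_sub_sum_vertexMap_mem [Fintype I] {e : ∀ i, Ω i} (he : IsVertexSystem k e)
    (z : GenPathAlgebra k D Ω) :
    ∃ a : ∀ i, Ω i, z - ∑ i, vertexMap k D i (a i) ∈ arrowIdeal k D e := by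
  classical
  let ν : (∀ i, Ω i) →ₗ[k] GenPathAlgebra k D Ω :=
    ∑ i, vertexMap k D i ∘ₗ LinearMap.proj i
  have hν : ∀ a, ν a = ∑ i, vertexMap k D i (a i) := fun a => by simp [ν]
  have hz := mem_of_forall_ofPath_mem
    ((arrowIdeal k D e).toSubmodule ⊔ LinearMap.range ν) ?_ z
  · obtain ⟨y, hy, _, ⟨a, rfl⟩, rfl⟩ := Submodule.mem_sup.1 hz
    refine ⟨a, ?_⟩
    rw [hν, add_sub_cancel_right]
    exact hy
  · intro i j p
    cases p with
    | nil a =>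
      refine Submodule.mem_sup_right ⟨Pi.single i a, ?_⟩
      rw [hν, Finset.sum_eq_single i]
      · rw [Pi.single_eq_same, vertexMap_apply]
      · intro j _ hj
        rw [Pi.single_eq_of_ne hj, map_zero]
      · simp
    | cons a x p => exact Submodule.mem_sup_left (ofPath_cons_mem he a x p)

/-- No non-zero vertex element lies in the ideal generated by the arrows. -/
theorem eq_zero_of_vertexMap_mem [∀ i, IsScalarTower k (Ω i) (Ω i)]
    [∀ i, SMulCommClass k (Ω i) (Ω i)] {e : ∀ i, Ω i} {i : I} {a : Ω i}
    (ha : vertexMap k D i a ∈ arrowIdeal k D e) : a = 0 := by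
  classical
  -- Evaluation in the product of the vertex algebras with all arrows sent to 0 kills J but is
  -- injective on each `Ω i`.
  let σ : ∀ i, Ω i →ₙₐ[k] (∀ i, Ω i) := fun i =>
    { toFun := Pi.single i
      map_smul' := fun c a => Pi.single_smul i c a
      map_zero' := Pi.single_zero i
      map_add' := Pi.single_add i
      map_mul' := Pi.single_mul i }
  have hσ : ∀ i j, i ≠ j → ∀ a b, σ i a * σ j b = 0 := by
    intro i j hij a b
    change Pi.single i a * Pi.single j b = 0
    funext l
    by_cases hl : l = i
    · subst hl
      simp [Pi.single_eq_of_ne hij]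
    · simp [Pi.single_eq_of_ne hl]
  have h := AlgIdeal.span_induction
    (AlgIdeal.comap (lift (D := D) σ hσ fun _ _ _ => 0) (AlgIdeal.zero k _)) ?_ ha
  · rw [AlgIdeal.mem_comap, AlgIdeal.mem_zero, vertexMap_apply, lift_ofPath] at h
    exact Pi.single_eq_zero_iff.1 h
  · rintro _ ⟨i, j, x, rfl⟩
    rw [AlgIdeal.mem_comap, AlgIdeal.mem_zero, lift_ofPath]
    change σ i (e i) * (0 * _) = 0
    rw [zero_mul, mul_zero]

end Paths

end GenPathAlgebra

/-! ## The number of vertices -/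

section VertexBound

variable {k : Type*} {R : Type*} [Field k] [NonUnitalRing R] [Module k R]

/-- In a simple ring, `a b c = 0` for all `b` only if `a x = 0` for all `x` or `c = 0`. -/
theorem IsSimpleRing.mul_eq_zero_of_forall_mul_mul {S : Type*} [NonUnitalRing S]
    [IsSimpleRing S] {a c : S} (hc : c ≠ 0) (hac : a * c = 0) (h : ∀ b, a * b * c = 0) (x : S) :
    a * x = 0 := by
  -- The right annihilator of a and of all products ab is a two-sided ideal containing c, so by
  -- simplicity it is everything. The condition on a alone is separate because `S` need not have a
  -- unity.
  let T : TwoSidedIdeal S := TwoSidedIdeal.mk' {x | a * x = 0 ∧ ∀ b, a * b * x = 0}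
    ⟨mul_zero a, fun b => mul_zero _⟩
    (fun {x y} hx hy => ⟨by rw [mul_add, hx.1, hy.1, add_zero],
      fun b => by rw [mul_add, hx.2, hy.2, add_zero]⟩)
    (fun {x} hx => ⟨by rw [mul_neg, hx.1, neg_zero], fun b => by rw [mul_neg, hx.2, neg_zero]⟩)
    (fun {x y} hy => ⟨by rw [← mul_assoc, hy.2],
      fun b => by rw [← mul_assoc, mul_assoc a, hy.2]⟩)
    (fun {x y} hx => ⟨by rw [← mul_assoc, hx.1, zero_mul],
      fun b => by rw [← mul_assoc, hx.2, zero_mul]⟩)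
  have hT : ∀ x, x ∈ T ↔ a * x = 0 ∧ ∀ b, a * b * x = 0 := fun x => by
    simp only [T, TwoSidedIdeal.mem_mk', Set.mem_ofPred_eq]
  have hcT : c ∈ T := (hT c).2 ⟨hac, h⟩
  rcases eq_bot_or_eq_top T with h' | h'
  · rw [h', TwoSidedIdeal.mem_bot] at hcT
    exact absurd hcT hc
  · exact ((hT x).1 (h' ▸ trivial)).1

/-- Each `E i` has a non-zero component in some summand. Two of them in the same simple summand
would contradict primeness, so the choice of summand is injective. -/
theorem IsAlgDirectSum.card_le {n : ℕ} {B : Fin n → NonUnitalSubalgebra k R}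
    (hB : IsAlgDirectSum B) (hs : ∀ i, IsSimpleRing (B i)) {u : R}
    (hu : ∀ a, u * a = a ∧ a * u = a) {I : Type*} {E : I → R} (h0 : ∀ i, E i ≠ 0)
    (hE : ∀ i j, i ≠ j → ∀ a, E i * a * E j = 0) : ENat.card I ≤ n := by
  obtain ⟨c, hcu, hc, hc'⟩ := hB.exists_units hu
  have hex : ∀ i, ∃ l, (c l : R) * E i ≠ 0 := by
    intro i
    by_contra! h
    apply h0 i
    rw [← (hu (E i)).1, ← hcu, Finset.sum_mul]
    exact Finset.sum_eq_zero fun l _ => h l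
  choose g hg using hex
  have hinj : Function.Injective g := by
    intro i j hij
    by_contra hne
    let a : B (g i) := ⟨c (g i) * E i, hB.unit_mul_mem hc _ _⟩
    let b : B (g i) := ⟨c (g i) * E j, hB.unit_mul_mem hc _ _⟩
    have hb : b ≠ 0 := fun h => hg j (by
      rw [← hij]
      exact congrArg Subtype.val h)
    have hs := hs (g i)
    have hab : a * b = 0 := Subtype.ext (by
      change (c (g i) : R) * E i * (c (g i) * E j) = 0
      rw [mul_assoc, ← mul_assoc (E i), hE i j hne, mul_zero])
    have := IsSimpleRing.mul_eq_zero_of_forall_mul_mul hb hab (fun z => Subtype.ext (by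
      change (c (g i) : R) * E i * z * (c (g i) * E j) = 0
      have : (c (g i) : R) * E i * z * (c (g i) * E j) =
          c (g i) * (E i * (z * c (g i)) * E j) := by
        simp only [mul_assoc]
      rw [this, hE i j hne, mul_zero])) (c (g i))
    rw [hc'] at this
    exact hg i (congrArg Subtype.val this)
  have := ENat.card_le_card_of_injective hinj
  rwa [ENat.card_eq_coe_fintype_card (α := Fin n), Fintype.card_fin] at this

/-- The image of an ideal in a quotient. -/
def AlgIdeal.Quotient.mapMk (K I : AlgIdeal k R) : AlgIdeal k K.Quotient where
  toSubmodule := I.toSubmodule.map (AlgIdeal.Quotient.mk K)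
  mul_mem_left' := by
    rintro a _ ⟨b, hb, rfl⟩
    obtain ⟨a, rfl⟩ := AlgIdeal.Quotient.mk_surjective K a
    exact ⟨a * b, I.mul_mem_left a hb, rfl⟩
  mul_mem_right' := by
    rintro a _ ⟨b, hb, rfl⟩
    obtain ⟨a, rfl⟩ := AlgIdeal.Quotient.mk_surjective K a
    exact ⟨b * a, I.mul_mem_right a hb, rfl⟩

theorem AlgIdeal.Quotient.mapMk_pow_le (K I : AlgIdeal k R) (n : ℕ) :
    (mapMk K I).pow (n + 1) ≤ (I.pow (n + 1)).map (mk K) := by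
  induction n with
  | zero => exact le_rfl
  | succ n ih =>
    refine Submodule.span_le.2 ?_
    rintro _ ⟨a, ha, _, ⟨b, hb, rfl⟩, rfl⟩
    obtain ⟨a, ha', rfl⟩ := ih ha
    exact ⟨a * b, Submodule.subset_span ⟨a, ha', b, hb, rfl⟩, rfl⟩

theorem AlgIdeal.Quotient.mapMk_isNilpotent {K I : AlgIdeal k R} {t : ℕ} (ht : 1 ≤ t)
    (h : I.pow t ≤ K.toSubmodule) : (mapMk K I).IsNilpotent := by
  refine ⟨t, ht, ?_⟩
  obtain ⟨n, rfl⟩ := Nat.exists_eq_add_of_le' ht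
  rw [eq_bot_iff]
  intro a ha
  obtain ⟨a, ha', rfl⟩ := mapMk_pow_le K I n ha
  exact (mk_eq_zero K).2 (h ha')

end VertexBound

theorem card_le_wedderburnArtinNumber (k : Type y) [Field k] (I : Type u) (D : I → I → Type v)
    (Ω : I → Type w) [∀ i, NonUnitalRing (Ω i)] [∀ i, Module k (Ω i)]
    [∀ i, IsScalarTower k (Ω i) (Ω i)] [∀ i, SMulCommClass k (Ω i) (Ω i)]
    (e : ∀ i, Ω i) (ρ : Set (GenPathAlgebra k D Ω))
    (he : IsVertexSystem k e) (hρ : IsWeakRelations k D e ρ) :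
    ENat.card I ≤ wedderburnArtinNumber k (GenPathAlgebraMod k ρ) := by
  obtain ⟨-, ⟨t, ht, htJ⟩, hJ⟩ := hρ
  rw [wedderburnArtinNumber]
  split_ifs with h
  · obtain ⟨⟨u, -, hu⟩, -⟩ := h
    -- The bound is proved for each decomposition into simple summands, so neither existence nor
    -- uniqueness of one matters here.
    refine le_sInf ?_
    rintro _ ⟨n, rfl, B, hB, hs⟩
    refine hB.card_le hs hu (E := fun i => AlgIdeal.Quotient.mk _
      (AlgIdeal.Quotient.mk _ (GenPathAlgebra.vertexMap k D i (e i)))) ?_ ?_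
    · intro i hi
      have hee : GenPathAlgebra.vertexMap k D i (e i) * GenPathAlgebra.vertexMap k D i (e i) =
          GenPathAlgebra.vertexMap k D i (e i) := by
        rw [GenPathAlgebra.vertexMap_apply, GenPathAlgebra.ofPath_mul_ofPath]
        change GenPathAlgebra.ofPath k D (OmegaPath.nil (e i * e i)) = _
        rw [he.e_mul]
      rw [AlgIdeal.Quotient.mk_eq_zero] at hi
      have := eq_zero_of_mem_jacobsonRadical_of_idempotent hi (by
        rw [← AlgIdeal.Quotient.mk_mul, hee])
      rw [AlgIdeal.Quotient.mk_eq_zero] at this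
      exact he.e_ne_zero i (GenPathAlgebra.eq_zero_of_vertexMap_mem (hJ this))
    · intro i j hij a
      obtain ⟨a, rfl⟩ := AlgIdeal.Quotient.mk_surjective _ a
      obtain ⟨a, rfl⟩ := AlgIdeal.Quotient.mk_surjective _ a
      rw [← AlgIdeal.Quotient.mk_mul, ← AlgIdeal.Quotient.mk_mul, ← AlgIdeal.Quotient.mk_mul,
        ← AlgIdeal.Quotient.mk_mul, AlgIdeal.Quotient.mk_eq_zero]
      -- The image of J modulo (ρ) is a nilpotent ideal and therefore lies in the radical.
      refine mem_jacobsonRadical_of_mem (fun b hb => AlgIdeal.isQuasiregular_of_isNilpotent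
        (AlgIdeal.Quotient.mapMk_isNilpotent ht htJ) hb) ?_
      exact ⟨_, GenPathAlgebra.vertex_mul_mul_vertex_mem he hij _ _ _, rfl⟩
  · exact le_top

/-! ## Presentation by generalized paths -/

section Presentation

variable {k : Type y} [Field k] {Λ : Type x}

/-- A linear complement of the radical that is a subalgebra gives a multiplicative section of the
projection onto the quotient. -/
theorem CanBeLifted.exists_section [NonUnitalRing Λ] [Module k Λ] (h : CanBeLifted k Λ) :
    ∃ s : (jacobsonRadical k Λ).Quotient →ₙₐ[k] Λ, ∀ a, AlgIdeal.Quotient.mk _ (s a) = a := by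
  obtain ⟨S, hS⟩ := h
  have hex : ∀ a : (jacobsonRadical k Λ).Quotient, ∃ b ∈ S, AlgIdeal.Quotient.mk _ b = a := by
    intro a
    obtain ⟨a, rfl⟩ := AlgIdeal.Quotient.mk_surjective _ a
    have ha : a ∈ S.toSubmodule ⊔ (jacobsonRadical k Λ).toSubmodule := by
      rw [hS.sup_eq_top]
      trivial
    obtain ⟨b, hb, c, hc, rfl⟩ := Submodule.mem_sup.1 ha
    refine ⟨b, hb, ?_⟩
    rw [map_add, (AlgIdeal.Quotient.mk_eq_zero _).2 hc, add_zero]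
  choose s hsS hs using hex
  have huniq : ∀ a ∈ S, ∀ b ∈ S, AlgIdeal.Quotient.mk (jacobsonRadical k Λ) a =
      AlgIdeal.Quotient.mk _ b → a = b := by
    intro a ha b hb hab
    rw [AlgIdeal.Quotient.mk_eq_mk] at hab
    exact sub_eq_zero.1 (Submodule.disjoint_def.1 hS.disjoint _
      (S.toSubmodule.sub_mem ha hb) hab)
  refine ⟨{ toFun := s, map_smul' := ?_, map_zero' := ?_, map_add' := ?_, map_mul' := ?_ }, hs⟩
  · intro c a
    refine huniq _ (hsS _) _ (S.toSubmodule.smul_mem c (hsS _)) ?_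
    change _ = AlgIdeal.Quotient.mk _ (c • s a)
    rw [map_smul, hs, hs]
  · refine huniq _ (hsS _) _ S.zero_mem ?_
    rw [map_zero, hs]
  · intro a b
    refine huniq _ (hsS _) _ (S.add_mem (hsS _) (hsS _)) ?_
    rw [map_add, hs, hs, hs]
  · intro a b
    refine huniq _ (hsS _) _ (S.mul_mem (hsS _) (hsS _)) ?_
    rw [AlgIdeal.Quotient.mk_mul, hs, hs, hs]

/-- A summand of an algebra without quasi-regular ideals has radical zero. -/
theorem IsAlgDirectSum.jacobsonRadical_eq_bot {R : Type*} [NonUnitalRing R] [Module k R] {n : ℕ}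
    {B : Fin n → NonUnitalSubalgebra k R} (hB : IsAlgDirectSum B)
    (h0 : ∀ I : AlgIdeal k R, (∀ b ∈ I, IsQuasiregular b) → ∀ a ∈ I, a = 0) (i : Fin n) :
    (jacobsonRadical k (B i)).toSubmodule = ⊥ := by
  rw [eq_bot_iff]
  intro a ha
  -- Elements of `R` act on a summand through their component in it, so the radical of `B i` is a
  -- quasi-regular ideal of all of `R`.
  refine Subtype.ext (h0
    { toSubmodule := (jacobsonRadical k (B i)).toSubmodule.map
        ((NonUnitalSubalgebraClass.subtype (B i) : B i →ₙₐ[k] R) : B i →ₗ[k] R)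
      mul_mem_left' := ?_
      mul_mem_right' := ?_ } ?_ a ⟨a, ha, rfl⟩)
  · rintro b _ ⟨d, hd, rfl⟩
    obtain ⟨b, rfl⟩ := hB.exists_sum_eq b
    exact ⟨b i * d, AlgIdeal.mul_mem_left _ _ hd, (hB.sum_mul i d b).symm⟩
  · rintro b _ ⟨d, hd, rfl⟩
    obtain ⟨b, rfl⟩ := hB.exists_sum_eq b
    exact ⟨d * b i, AlgIdeal.mul_mem_right _ _ hd, (hB.mul_sum i d b).symm⟩
  · rintro _ ⟨d, hd, rfl⟩
    exact (isQuasiregular_of_mem_jacobsonRadical hd).map (NonUnitalSubalgebraClass.subtype (B i))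

/-- An algebra is isomorphic to the quotient of any algebra that maps onto it by the kernel. -/
theorem algIsomorphic_quotient_of_surjective {A B : Type*} [NonUnitalRing A] [Module k A]
    [NonUnitalRing B] [Module k B] (f : A →ₙₐ[k] B) (hf : Function.Surjective f)
    {I : AlgIdeal k A} (hI : ∀ a, a ∈ I ↔ f a = 0) : AlgIsomorphic k B I.Quotient := by
  have hg : ∀ b, ∃ a : I.Quotient, AlgIdeal.Quotient.lift f (fun a => (hI a).1) a = b := by
    intro b
    obtain ⟨a, rfl⟩ := hf b
    exact ⟨AlgIdeal.Quotient.mk I a, rfl⟩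
  have hinj : Function.Injective (AlgIdeal.Quotient.lift f (fun a => (hI a).1)) := by
    rw [injective_iff_map_eq_zero]
    intro a ha
    obtain ⟨a, rfl⟩ := AlgIdeal.Quotient.mk_surjective I a
    exact (AlgIdeal.Quotient.mk_eq_zero I).2 ((hI a).2 ha)
  choose g hg using hg
  refine ⟨{ toFun := g, map_smul' := ?_, map_zero' := ?_, map_add' := ?_, map_mul' := ?_ },
    ?_, ?_⟩
  · intro c b
    apply hinj
    rw [hg, MonoidHom.id_apply, map_smul, hg]
  · apply hinj
    rw [hg, map_zero]
  · intro b b'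
    apply hinj
    rw [hg, map_add, hg, hg]
  · intro b b'
    apply hinj
    rw [hg, map_mul, hg, hg]
  · intro b b' h
    have h : g b = g b' := h
    rw [← hg b, h, hg]
  · intro a
    exact ⟨_, hinj (hg _)⟩

theorem AlgIdeal.Quotient.mk_one_mul_and_mul_mk_one {A : Type*} [Ring A] [Module k A]
    (I : AlgIdeal k A) (a : I.Quotient) : mk I 1 * a = a ∧ a * mk I 1 = a := by
  obtain ⟨a, rfl⟩ := mk_surjective I a
  rw [← mk_mul, ← mk_mul, one_mul, mul_one]
  exact ⟨rfl, rfl⟩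

theorem exists_genPathAlgebraMod_of_isAlgDirectSum [Ring Λ] [Algebra k Λ]
    (hlift : CanBeLifted k Λ) (hnil : (jacobsonRadical k Λ).IsNilpotent) (n : ℕ)
    (B : Fin n → NonUnitalSubalgebra k (jacobsonRadical k Λ).Quotient)
    (hB : IsAlgDirectSum B) (hB0 : ∀ i, B i ≠ ⊥) :
    ∃ (D : Fin n → Fin n → Type x) (e : ∀ i, B i)
      (ρ : Set (GenPathAlgebra k D (fun i => B i))),
      IsVertexSystem k e ∧ IsWeakRelations k D e ρ ∧
      AlgIsomorphic k Λ (GenPathAlgebraMod k ρ) := by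
  obtain ⟨s, hs⟩ := hlift.exists_section
  have hu := AlgIdeal.Quotient.mk_one_mul_and_mul_mk_one (jacobsonRadical k Λ)
  obtain ⟨e, heu, he, he'⟩ := hB.exists_units hu
  have hvs : IsVertexSystem k e :=
    { e_ne_zero := fun i h => hB0 i (by
        rw [eq_bot_iff]
        intro a ha
        have := congrArg Subtype.val (he i ⟨a, ha⟩)
        rw [h, zero_mul] at this
        rw [NonUnitalAlgebra.mem_bot]
        exact this.symm)
      e_mul := he
      mul_e := he'
      radical_eq_zero :=
        hB.jacobsonRadical_eq_bot fun _ hI _ => eq_zero_of_mem_quasiregular_quotient_radical hI }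
  -- The difference 1 - s(1) is an idempotent lying in the radical, hence zero.
  have hs1 : ∑ i, s (e i) = 1 := by
    rw [← map_sum, heu]
    have hid : s (AlgIdeal.Quotient.mk _ 1) * s (AlgIdeal.Quotient.mk _ 1) =
        s (AlgIdeal.Quotient.mk _ 1) := by
      rw [← map_mul, (hu _).1]
    refine (sub_eq_zero.1 (eq_zero_of_mem_jacobsonRadical_of_idempotent (k := k) ?_ ?_)).symm
    · rw [← AlgIdeal.Quotient.mk_eq_mk, hs]
    · rw [mul_sub, sub_mul, sub_mul, hid]
      simp
  let D : Fin n → Fin n → Type x := fun _ _ => {a : Λ // a ∈ jacobsonRadical k Λ}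
  let σ : ∀ i, B i →ₙₐ[k] Λ := fun i => s.comp (NonUnitalSubalgebraClass.subtype (B i))
  have hσs : ∀ i (a : B i), σ i a = s a := fun _ _ => rfl
  have hσ : ∀ i j, i ≠ j → ∀ a b, σ i a * σ j b = 0 := by
    intro i j hij a b
    rw [hσs, hσs, ← map_mul, hB.2 i j hij _ a.2 _ b.2, map_zero]
  let φ : GenPathAlgebra k D (fun i => B i) →ₙₐ[k] Λ :=
    GenPathAlgebra.lift σ hσ fun _ _ a => a.1
  have hφv : ∀ i (a : B i), φ (GenPathAlgebra.vertexMap k D i a) = s a := fun i a =>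
    GenPathAlgebra.lift_ofPath hσ _
  have hφJ : ∀ z ∈ arrowIdeal k D e, φ z ∈ jacobsonRadical k Λ := by
    refine fun z hz => AlgIdeal.span_induction (AlgIdeal.comap φ (jacobsonRadical k Λ)) ?_ hz
    rintro _ ⟨i, j, a, rfl⟩
    rw [AlgIdeal.mem_comap]
    change GenPathAlgebra.lift σ hσ _ _ ∈ _
    rw [GenPathAlgebra.lift_ofPath]
    exact AlgIdeal.mul_mem_left _ _ (AlgIdeal.mul_mem_right _ _ a.2)
  have hsurj : Function.Surjective φ := by
    intro a
    obtain ⟨b, hb⟩ := hB.exists_sum_eq (AlgIdeal.Quotient.mk _ a)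
    let r := a - s (AlgIdeal.Quotient.mk _ a)
    have hr : r ∈ jacobsonRadical k Λ := by
      rw [← AlgIdeal.Quotient.mk_eq_mk, hs]
    refine ⟨∑ i, GenPathAlgebra.vertexMap k D i (b i) +
      ∑ i, ∑ j, GenPathAlgebra.ofPath k D
        (OmegaPath.cons (j := j) (e i) ⟨r, hr⟩ (OmegaPath.nil (e j))), ?_⟩
    have h1 : φ (∑ i, GenPathAlgebra.vertexMap k D i (b i)) = s (AlgIdeal.Quotient.mk _ a) := by
      rw [map_sum, ← hb, map_sum]
      exact Finset.sum_congr rfl fun i _ => hφv i (b i)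
    have h2 : φ (∑ i, ∑ j, GenPathAlgebra.ofPath k D
        (OmegaPath.cons (j := j) (e i) ⟨r, hr⟩ (OmegaPath.nil (e j)))) = r := by
      -- The two-sided Peirce decomposition of r writes it as a sum of values of one-arrow paths,
      -- one for each pair of vertices.
      have : r = (∑ i, s (e i)) * (r * ∑ j, s (e j)) := by rw [hs1, one_mul, mul_one]
      refine Eq.trans ?_ this.symm
      rw [map_sum, Finset.sum_mul]
      refine Finset.sum_congr rfl fun i _ => ?_
      rw [map_sum, Finset.mul_sum, Finset.mul_sum]
      exact Finset.sum_congr rfl fun j _ => GenPathAlgebra.lift_ofPath hσ _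
    rw [map_add, h1, h2]
    exact add_sub_cancel _ _
  have hker : ∀ z, φ z = 0 → z ∈ arrowIdeal k D e := by
    intro z hz
    obtain ⟨a, ha⟩ := GenPathAlgebra.exists_sub_sum_vertexMap_mem hvs z
    have h := hφJ _ ha
    rw [map_sub, hz, ← AlgIdeal.Quotient.mk_eq_mk, map_zero, map_sum] at h
    -- Modulo the radical, φ recovers the vertex part of z. Since φ z = 0, that part vanishes, and z
    -- itself lies in J.
    have h' : ∑ i, (a i : (jacobsonRadical k Λ).Quotient) = 0 := by
      rw [h, map_sum]
      refine Finset.sum_congr rfl fun i _ => ?_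
      rw [hφv, hs]
    rw [hB.eq_zero_of_sum_eq_zero he h'] at ha
    simpa using ha
  have hspan : ∀ z, z ∈ AlgIdeal.span (k := k) {z | φ z = 0} ↔ φ z = 0 := fun z =>
    ⟨fun hz => AlgIdeal.span_induction (AlgIdeal.comap φ (AlgIdeal.zero k Λ)) (fun _ h => h) hz,
      fun hz => AlgIdeal.subset_span hz⟩
  refine ⟨D, e, {z | φ z = 0}, hvs, ⟨⟨0, map_zero φ⟩, ?_, ?_⟩,
    algIsomorphic_quotient_of_surjective φ hsurj hspan⟩
  · obtain ⟨t, ht, hrt⟩ := hnil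
    refine ⟨t, ht, fun z hz => (hspan z).2 ?_⟩
    obtain ⟨m, rfl⟩ := Nat.exists_eq_add_of_le' ht
    have := AlgIdeal.map_mem_pow φ _ _ hφJ m hz
    rw [hrt] at this
    exact this
  · exact fun z hz => hker z ((hspan z).1 hz)

/-- Every number of non-zero summands up to the Wedderburn–Artin number occurs. -/
theorem exists_isAlgDirectSum_of_le_wedderburnArtinNumber [Ring Λ] [Nontrivial Λ]
    [Algebra k Λ] (hart : IsArtinianAlg k (jacobsonRadical k Λ).Quotient) {m : ℕ} (hm : 1 ≤ m)
    (hmn : (m : ℕ∞) ≤ wedderburnArtinNumber k Λ) :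
    ∃ B : Fin m → NonUnitalSubalgebra k (jacobsonRadical k Λ).Quotient,
      IsAlgDirectSum B ∧ ∀ i, B i ≠ ⊥ := by
  have hu := AlgIdeal.Quotient.mk_one_mul_and_mul_mk_one (jacobsonRadical k Λ)
  have hu0 : AlgIdeal.Quotient.mk (jacobsonRadical k Λ) 1 ≠ 0 := fun h =>
    one_ne_zero (eq_zero_of_mem_jacobsonRadical_of_idempotent
      ((AlgIdeal.Quotient.mk_eq_zero _).1 h) (mul_one 1))
  obtain ⟨n₀, B₀, hB₀⟩ := hart.exists_isAlgDirectSum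
    (fun _ hI _ => eq_zero_of_mem_quasiregular_quotient_radical hI) hu
  rw [wedderburnArtinNumber, if_pos ⟨⟨_, hu0, hu⟩, hart⟩] at hmn
  -- The Wedderburn–Artin number is an infimum, so m is at most the length n₀ of the decomposition
  -- just obtained.
  have hmn := hmn.trans (sInf_le ⟨n₀, rfl, B₀, hB₀⟩)
  obtain ⟨hB, hs⟩ := hB₀
  refine hB.exists_of_le (fun i h => ?_) hu hm (Nat.cast_le.1 hmn)
  have := hs i
  obtain ⟨T, hT⟩ := exists_ne (⊥ : TwoSidedIdeal (B₀ i))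
  refine hT (eq_bot_iff.2 fun a _ => ?_)
  rw [TwoSidedIdeal.mem_bot]
  refine Subtype.ext ((NonUnitalAlgebra.mem_bot (R := k)).1 ?_)
  rw [← h]
  exact a.2

end Presentation

theorem corollary3p11 (k : Type y) [Field k] :
    -- (i) the number of vertices is at most the Wedderburn–Artin number
    (∀ (I : Type u) (D : I → I → Type v) (Ω : I → Type w)
        [∀ i, NonUnitalRing (Ω i)] [∀ i, Module k (Ω i)]
        [∀ i, IsScalarTower k (Ω i) (Ω i)] [∀ i, SMulCommClass k (Ω i) (Ω i)]
        (e : ∀ i, Ω i) (ρ : Set (GenPathAlgebra k D Ω)),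
        IsVertexSystem k e → IsWeakRelations k D e ρ →
        ENat.card I ≤ wedderburnArtinNumber k (GenPathAlgebraMod k ρ)) ∧
    -- (ii) a decomposition of `Λ / r` is realized by the vertex algebras
    (∀ (Λ : Type x) [Ring Λ] [Nontrivial Λ] [Algebra k Λ],
        CanBeLifted k Λ → (jacobsonRadical k Λ).IsNilpotent →
        ∀ (n : ℕ) (B : Fin n → NonUnitalSubalgebra k (jacobsonRadical k Λ).Quotient),
          IsAlgDirectSum B → (∀ i, B i ≠ ⊥) →
          ∃ (D : Fin n → Fin n → Type x) (e : ∀ i, B i)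
            (ρ : Set (GenPathAlgebra k D (fun i => B i))),
            IsVertexSystem k e ∧ IsWeakRelations k D e ρ ∧
            AlgIsomorphic k Λ (GenPathAlgebraMod k ρ)) ∧
    -- (iii) every number `m ≥ 1` of vertices up to the Wedderburn–Artin number occurs
    (∀ (Λ : Type x) [Ring Λ] [Nontrivial Λ] [Algebra k Λ],
        CanBeLifted k Λ → (jacobsonRadical k Λ).IsNilpotent →
        IsArtinianAlg k (jacobsonRadical k Λ).Quotient →
        ∀ m : ℕ, 1 ≤ m → (m : ℕ∞) ≤ wedderburnArtinNumber k Λ →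
          ∃ (D : Fin m → Fin m → Type x) (Ω : Fin m → Type x)
            (_ : ∀ i, NonUnitalRing (Ω i)) (_ : ∀ i, Module k (Ω i))
            (_ : ∀ i, IsScalarTower k (Ω i) (Ω i)) (_ : ∀ i, SMulCommClass k (Ω i) (Ω i))
            (e : ∀ i, Ω i) (ρ : Set (GenPathAlgebra k D Ω)),
            IsVertexSystem k e ∧ IsWeakRelations k D e ρ ∧
            AlgIsomorphic k Λ (GenPathAlgebraMod k ρ)) := by
  refine ⟨fun I D Ω _ _ _ _ e ρ => card_le_wedderburnArtinNumber k I D Ω e ρ,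
    fun Λ _ _ _ hlift hnil n B hB hB0 =>
      exists_genPathAlgebraMod_of_isAlgDirectSum hlift hnil n B hB hB0,
    fun Λ _ _ _ hlift hnil hart m hm hmn => ?_⟩
  obtain ⟨B, hB, hB0⟩ := exists_isAlgDirectSum_of_le_wedderburnArtinNumber hart hm hmn
  obtain ⟨D, e, ρ, h⟩ := exists_genPathAlgebraMod_of_isAlgDirectSum hlift hnil m B hB hB0
  exact ⟨D, fun i => B i, inferInstance, inferInstance, inferInstance, inferInstance, e, ρ, h⟩
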